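/- For $i=1,2$ let $M_i$ be a II$_1$ factor, i.e. an infinite-dimensional von Neumann algebra with trivial center having a faithful normal tracial state, with (unique) faithful normal tracial state $\tau_i$, and unitary group $\mathcal U(M_i)$; let $G_i$ be a discrete group with identity $e$. Write $\operatorname{Ad}u(x)=uxu^*$. Let $(\alpha^i,v^i)$ be a properly outer cocycle action of $G_i$ on $M_i$ with normalized 2-cocycle, i.e. maps $\alpha^i:G_i\to\operatorname{Aut}(M_i)$ and $v^i:G_i\times G_i\to\mathcal U(M_i)$ with $$\alpha^i_e=\mathrm{id},\quad \alpha^i_g\alpha^i_h=\operatorname{Ad}(v^i_{g,h})\,\alpha^i_{gh},\quad v^i_{g,h}v^i_{gh,k}=\alpha^i_g(v^i_{h,k})v^i_{g,hk},\quad v^i_{g,e}=v^i_{e,g}=1$$ for all $g,h,k\in G_i$, such that for $g\ne e$ the automorphism $\alpha^i_g$ is not of the form $\operatorname{Ad}u$ with $u\in\mathcal U(M_i)$. Let $M_i\rtimes_{\alpha^i}G_i$ be the crossed product: the von Neumann algebra on $\ell^2(G_i,L^2(M_i,\tau_i))$ generated by the copy of $M_i$ given by $(x\cdot f)(h)=(\alpha^i_h)^{-1}(x)f(h)$,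 $x\in M_i$, and by the unitaries $u_g$, $g\in G_i$, given by $(u_gf)(h)=(\alpha^i_h)^{-1}(v^i_{g,g^{-1}h})\,f(g^{-1}h)$. Regard $M_i$ as a subalgebra of $M_i\rtimes_{\alpha^i}G_i$ through this copy. **Proposition 1.7.** If $\Phi:M_1\rtimes_{\alpha^1}G_1\to M_2\rtimes_{\alpha^2}G_2$ is a surjective $*$-isomorphism with $\Phi(M_1)=M_2$, then $\alpha^1$ and $\alpha^2$ are cocycle conjugate. More precisely, there exist a group isomorphism $\gamma:G_1\to G_2$ and unitaries $w_g\in\mathcal U(M_2)$, $g\in G_1$, such that, with $\Phi$ in (i), (ii) denoting the restricted $*$-isomorphism $M_1\to M_2$, (i) $\Phi\,\alpha^1_g\,\Phi^{-1}=\operatorname{Ad}w_g\circ\alpha^2_{\gamma(g)}$ for all $g\in G_1$, (ii) $\Phi(v^1_{g,h})=w_g\,\alpha^2_{\gamma(g)}(w_h)\,v^2_{\gamma(g),\gamma(h)}\,w_{gh}^*$ for all $g,h\in G_1$. Conversely, if $\Phi:M_1\to M_2$ is a surjective $*$-isomorphism, $\gamma:G_1\to G_2$ is a group isomorphism, and $w_g\in\mathcal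 U(M_2)$, $g\in G_1$, are unitaries such that (i) and (ii) hold, then $\Phi$ extends to a $*$-isomorphism $M_1\rtimes_{\alpha^1}G_1\to M_2\rtimes_{\alpha^2}G_2$ (which hence maps $M_1$ onto $M_2$). -/

import Mathlib

open scoped ComplexOrder InnerProductSpace ENNReal

noncomputable section

/-! ### Von Neumann algebras, traces and II₁ factors -/

namespace VonNeumannAlgebra

/-- The ⋆-algebra of elements of a von Neumann algebra `M ⊆ B(H)`. -/
abbrev Elem {H : Type*} [NormedAddCommGroup H] [InnerProductSpace ℂ H] [CompleteSpace H]
    (M : VonNeumannAlgebra H) : Type _ := M.toStarSubalgebra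

variable {H : Type*} [NormedAddCommGroup H] [InnerProductSpace ℂ H] [CompleteSpace H]

instance instIsClosed (M : VonNeumannAlgebra H) :
    IsClosed (M.toStarSubalgebra : Set (H →L[ℂ] H)) := by
  change IsClosed M.carrier
  rw [← M.centralizer_centralizer']
  exact Set.isClosed_centralizer _

/-- The operator order of `B(H)`, restricted to `M`, is the order of the C⋆-algebra `M`. -/
instance instStarOrderedRingElem (M : VonNeumannAlgebra H) : StarOrderedRing M.Elem := by
  refine StarOrderedRing.of_nonneg_iff' (fun {x y} h z => ?_) (fun x => ⟨fun hx => ?_, ?_⟩)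
  · exact add_le_add_right (α := H →L[ℂ] H) h z
  · have hx' : (0 : H →L[ℂ] H) ≤ x := hx
    have hsa : IsSelfAdjoint x := Subtype.ext (IsSelfAdjoint.of_nonneg hx').star_eq
    have hs : SpectrumRestricts x ContinuousMap.realToNNReal := by
      rw [SpectrumRestricts.nnreal_iff]
      intro r hr
      rw [← spectrum.algebraMap_mem_iff ℂ, StarSubalgebra.mem_spectrum_iff,
        spectrum.algebraMap_mem_iff] at hr
      exact spectrum_nonneg_of_nonneg hx' hr
    obtain ⟨s, h1, -, h2⟩ := CFC.exists_sqrt_of_isSelfAdjoint_of_quasispectrumRestricts hsa hs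
    exact ⟨s, by rw [h1.star_eq, h2]⟩
  · rintro ⟨s, rfl⟩
    exact star_mul_self_nonneg (s : H →L[ℂ] H)

/-- A faithful normal tracial state `τ` on `M`. Normality (σ-weak continuity of a state) is
expressed by writing `τ` as a countable sum `∑ₙ ⟨x ξₙ, ξₙ⟩` of vector functionals with
`∑ₙ ‖ξₙ‖² < ∞`. -/
structure IsFaithfulNormalTrace (M : VonNeumannAlgebra H) (τ : M.Elem →ₚ[ℂ] ℂ) : Prop where
  map_one : τ 1 = 1
  map_mul_comm : ∀ x y : M.Elem, τ (x * y) = τ (y * x)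
  faithful : ∀ x : M.Elem, τ (star x * x) = 0 → x = 0
  normal : ∃ ξ : ℕ → H, (Summable fun n => ‖ξ n‖ ^ 2) ∧
    ∀ x : M.Elem, HasSum (fun n => ⟪ξ n, (x : H →L[ℂ] H) (ξ n)⟫_ℂ) (τ x)

/-- A II₁ factor: an infinite-dimensional von Neumann algebra with trivial center that has a
faithful normal tracial state. -/
structure IsTypeIIOneFactor (M : VonNeumannAlgebra H) : Prop where
  center_trivial : ∀ z : M.Elem, (∀ x : M.Elem, z * x = x * z) → ∃ c : ℂ, z = c • 1
  infinite_dimensional : ¬ FiniteDimensional ℂ M.Elem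
  exists_trace : ∃ τ : M.Elem →ₚ[ℂ] ℂ, M.IsFaithfulNormalTrace τ

/-- The von Neumann algebra generated by a set `S` of bounded operators: the double commutant of
`S ∪ S*`. -/
def generatedBy (S : Set (H →L[ℂ] H)) : VonNeumannAlgebra H where
  toStarSubalgebra :=
    StarSubalgebra.centralizer ℂ (StarSubalgebra.centralizer ℂ S : Set (H →L[ℂ] H))
  centralizer_centralizer' := by
    change Set.centralizer (Set.centralizer (SetLike.coe (StarSubalgebra.centralizer ℂ
      (StarSubalgebra.centralizer ℂ S : Set (H →L[ℂ] H))))) = SetLike.coe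
      (StarSubalgebra.centralizer ℂ (StarSubalgebra.centralizer ℂ S : Set (H →L[ℂ] H)))
    rw [StarSubalgebra.coe_centralizer_centralizer, Set.centralizer_centralizer_centralizer]

theorem subset_generatedBy (S : Set (H →L[ℂ] H)) {x : H →L[ℂ] H} (hx : x ∈ S) :
    x ∈ (generatedBy S).toStarSubalgebra := by
  change x ∈ SetLike.coe (StarSubalgebra.centralizer ℂ
      (StarSubalgebra.centralizer ℂ S : Set (H →L[ℂ] H)))
  rw [StarSubalgebra.coe_centralizer_centralizer]
  exact Set.subset_centralizer_centralizer (Or.inl hx)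

end VonNeumannAlgebra

/-! ### Cocycle actions -/

/-- A cocycle action `(α, v)` of a discrete group `G` on a unital ⋆-algebra `A`, with normalized
2-cocycle `v`. -/
structure CocycleAction (G : Type*) [Group G] (A : Type*) [Ring A] [StarRing A]
    [Algebra ℂ A] where
  /-- the automorphisms `α_g` -/
  aut : G → (A ≃⋆ₐ[ℂ] A)
  /-- the unitaries `v_{g,h}` -/
  coc : G → G → unitary A
  aut_one : ∀ x, aut 1 x = x
  aut_mul : ∀ g h x, aut g (aut h x) = coc g h * aut (g * h) x * star (coc g h : A)
  coc_assoc : ∀ g h k,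
    (coc g h : A) * coc (g * h) k = aut g (coc h k) * coc g (h * k)
  coc_one_left : ∀ g, coc 1 g = 1
  coc_one_right : ∀ g, coc g 1 = 1

namespace CocycleAction

variable {G : Type*} [Group G] {A : Type*} [Ring A] [StarRing A] [Algebra ℂ A]

/-- `α_g` is not implemented by a unitary of `A` when `g ≠ e`. -/
def ProperlyOuter (α : CocycleAction G A) : Prop :=
  ∀ g, g ≠ 1 → ¬ ∃ u : unitary A, ∀ x, α.aut g x = u * x * star (u : A)

variable {G₂ : Type*} [Group G₂] {A₂ : Type*} [Ring A₂] [StarRing A₂] [Algebra ℂ A₂]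

/-- The ⋆-isomorphism `Φ`, the group isomorphism `γ` and the unitaries `w_g` realize a cocycle
conjugacy of two cocycle actions. -/
structure IsCocycleConjugacy (α : CocycleAction G A) (β : CocycleAction G₂ A₂)
    (Φ : A ≃⋆ₐ[ℂ] A₂) (γ : G ≃* G₂) (w : G → unitary A₂) : Prop where
  /-- `Φ α_g Φ⁻¹ = Ad w_g ∘ β_{γ(g)}` -/
  conj_aut : ∀ (g : G) (y : A₂),
    Φ (α.aut g (Φ.symm y)) = w g * β.aut (γ g) y * star (w g : A₂)
  /-- `Φ(v_{g,h}) = w_g β_{γ(g)}(w_h) v'_{γ(g),γ(h)} w_{gh}*` -/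
  map_coc : ∀ g h : G,
    Φ (α.coc g h) = w g * β.aut (γ g) (w h) * β.coc (γ g) (γ h) * star (w (g * h) : A₂)

end CocycleAction

/-! ### Crossed products -/

/-- The bounded operator `(T f)(h) = T_h (f (σ h))` on `ℓ²(G, K)`, for a permutation `σ` of `G`
and a uniformly bounded family of operators `T_h` on `K`. -/
def weightedShift {G : Type*} {K : Type*} [NormedAddCommGroup K] [InnerProductSpace ℂ K]
    (σ : Equiv.Perm G) (T : G → K →L[ℂ] K) (C : ℝ) (hC : ∀ h, ‖T h‖ ≤ C) :
    lp (fun _ : G => K) 2 →L[ℂ] lp (fun _ : G => K) 2 :=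
  have hb : ∀ (f : lp (fun _ : G => K) 2) (h : G),
      ‖T h (f (σ h))‖ ^ 2 ≤ C ^ 2 * ‖f (σ h)‖ ^ 2 := fun f h => by
    rw [← mul_pow]
    gcongr
    exact (T h).le_of_opNorm_le (hC h) _
  have hs : ∀ f : lp (fun _ : G => K) 2, HasSum (fun h => C ^ 2 * ‖f (σ h)‖ ^ 2)
      (C ^ 2 * ‖f‖ ^ 2) := fun f => by
    have := lp.hasSum_norm (p := 2) (by simp) f
    simp only [ENNReal.toReal_ofNat, Real.rpow_ofNat] at this
    exact (σ.hasSum_iff.mpr this).mul_left _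
  have hm : ∀ f : lp (fun _ : G => K) 2, Memℓp (fun h => T h (f (σ h))) 2 := fun f => by
    apply memℓp_gen
    simp only [ENNReal.toReal_ofNat, Real.rpow_ofNat]
    exact (hs f).summable.of_nonneg_of_le (fun h => by positivity) (hb f)
  LinearMap.mkContinuous
    { toFun := fun f => ⟨fun h => T h (f (σ h)), hm f⟩
      map_add' := fun f f' => by
        ext h
        exact map_add (T h) (f (σ h)) (f' (σ h))
      map_smul' := fun c f => by
        ext h
        exact map_smul (T h) c (f (σ h)) }
    |C| fun f => by
      refine abs_le_of_sq_le_sq' ?_ (by positivity) |>.2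
      rw [mul_pow, sq_abs]
      have h1 := lp.hasSum_norm (p := 2) (by simp)
        (⟨fun h => T h (f (σ h)), hm f⟩ : lp (fun _ : G => K) 2)
      simp only [ENNReal.toReal_ofNat, Real.rpow_ofNat] at h1
      exact hasSum_le (hb f) h1 (hs f)

namespace CocycleAction

variable {H : Type*} [NormedAddCommGroup H] [InnerProductSpace ℂ H] [CompleteSpace H]
  {M : VonNeumannAlgebra H} {G : Type*} [Group G]

theorem norm_unitary_le_one {A : Type*} [CStarAlgebra A] (u : unitary A) : ‖(u : A)‖ ≤ 1 := by
  rcases subsingleton_or_nontrivial A with h | h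
  · simp [Subsingleton.elim (u : A) 0]
  · exact (CStarRing.norm_coe_unitary u).le

/-- The Hilbert space `ℓ²(G, L²(M, τ))`; here `L²(M, τ)` is the GNS space of `τ`. -/
abbrev L2 (_α : CocycleAction G M.Elem) (τ : M.Elem →ₚ[ℂ] ℂ) : Type _ :=
  lp (fun _ : G => τ.GNS) 2

/-- The copy of `M`: `(x · f)(h) = α_h⁻¹(x) f(h)`, where `M` acts on `L²(M, τ)` by left
multiplication. -/
def baseOp (α : CocycleAction G M.Elem) (τ : M.Elem →ₚ[ℂ] ℂ) (x : M.Elem) :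
    α.L2 τ →L[ℂ] α.L2 τ :=
  weightedShift (Equiv.refl G) (fun h => τ.gnsStarAlgHom ((α.aut h).symm x)) ‖x‖ fun h =>
    (NonUnitalStarAlgHom.norm_apply_le τ.gnsStarAlgHom _).trans
      (NonUnitalStarAlgHom.norm_apply_le (α.aut h).symm x)

/-- The unitary `u_g`: `(u_g f)(h) = α_h⁻¹(v_{g, g⁻¹h}) f(g⁻¹h)`. -/
def groupOp (α : CocycleAction G M.Elem) (τ : M.Elem →ₚ[ℂ] ℂ) (g : G) :
    α.L2 τ →L[ℂ] α.L2 τ :=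
  weightedShift (Equiv.mulLeft g⁻¹)
    (fun h => τ.gnsStarAlgHom ((α.aut h).symm (α.coc g (g⁻¹ * h)))) 1 fun h =>
    (NonUnitalStarAlgHom.norm_apply_le τ.gnsStarAlgHom _).trans
      ((NonUnitalStarAlgHom.norm_apply_le (α.aut h).symm _).trans
        (norm_unitary_le_one _))

/-- The crossed product `M ⋊_{α,v} G`: the von Neumann algebra on `ℓ²(G, L²(M, τ))` generated by
the copy of `M` and the unitaries `u_g`. -/
def crossedProduct (α : CocycleAction G M.Elem) (τ : M.Elem →ₚ[ℂ] ℂ) :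
    VonNeumannAlgebra (α.L2 τ) :=
  VonNeumannAlgebra.generatedBy (Set.range (α.baseOp τ) ∪ Set.range (α.groupOp τ))

/-- The canonical embedding of `M` into `M ⋊_{α,v} G`. -/
def base (α : CocycleAction G M.Elem) (τ : M.Elem →ₚ[ℂ] ℂ) (x : M.Elem) :
    (α.crossedProduct τ).Elem :=
  ⟨α.baseOp τ x, VonNeumannAlgebra.subset_generatedBy _ (Or.inl ⟨x, rfl⟩)⟩

end CocycleAction

end

/-! Forward direction. Let T be an isometry of the second crossed product with T y = θ(y) T on M,
for an automorphism θ of M. Formally T = ∑ u_h t_h with t_h ∈ M, and comparing coefficients gives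
t_h y = α_h⁻¹θ(y) t_h. In a factor a nonzero intertwiner of this kind is a multiple of a unitary, so
α_h⁻¹θ is inner; proper outerness allows this for only one index k. Hence T = w u_k with w a unitary
of M (`CocycleAction.exists_eq_repHom_mul_groupElem`). Applied to the images of the canonical
unitaries this gives Ψ(u_g) = w_g u_{γ(g)}. The images under Ψ of u_g x = α_g(x) u_g and u_g u_h =
v_{g,h} u_{gh}, with uniqueness of the decomposition w u_k, yield (i), (ii) and multiplicativity of
γ; the same for Ψ⁻¹ makes γ bijective.

Converse. Let V : L²(M₁) → L²(M₂) be the unitary implementing Φ. By (i) and (ii), (W f)(γ(l)) =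
α_{γ(l)}⁻¹(w_l) V f(l) defines a unitary W that conjugates x to Φ(x) and u_g to w_g u_{γ(g)}, so it
conjugates one crossed product onto the other.

Two analytic facts are needed. That t_h lies in M requires the commutation theorem: the commutant of
right multiplication on L²(M, τ) is M. That Φ and the α_g are implemented on L² requires them to
preserve the traces, although no normality of ⋆-isomorphisms is assumed. Both follow from a
Radon–Nikodym theorem for traces that are complete on [0, 1] in the 2-norm. This condition involves
only the algebra and its order, so every ⋆-isomorphism transports it, and faithful normal traces
satisfy it. For uniqueness, the sum of two complete traces is complete (a noncommutative
Borel–Cantelli argument), and the density of τ with respect to τ + φ is central, hence the scalar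
1/2. -/

noncomputable section

open Filter Topology Set

/-! ### Complete traces on C⋆-algebras -/

namespace PositiveLinearMap

variable {A : Type*} [CStarAlgebra A] [PartialOrder A] [StarOrderedRing A]

/-- A faithful tracial positive functional for which the order interval `[0, 1]` is complete in the
norm `‖x‖₂ = τ(x⋆x)^{1/2}`. -/
structure IsCompleteTrace (τ : A →ₚ[ℂ] ℂ) : Prop where
  map_mul_comm : ∀ x y, τ (x * y) = τ (y * x)
  faithful : ∀ x, τ (star x * x) = 0 → x = 0
  complete : ∀ x : ℕ → A, (∀ n, x n ∈ Icc 0 1) → CauchySeq (fun n => τ.toPreGNS (x n)) →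
    ∃ a, Tendsto (fun n => τ.toPreGNS (x n)) atTop (𝓝 (τ.toPreGNS a))

section general

variable (τ : A →ₚ[ℂ] ℂ)

theorem inner_toPreGNS (a b : A) : ⟪τ.toPreGNS a, τ.toPreGNS b⟫_ℂ = τ (star a * b) := rfl

theorem norm_toPreGNS_sq (a : A) : ‖τ.toPreGNS a‖ ^ 2 = (τ (star a * a)).re := by
  have := τ.preGNS_norm_sq (τ.toPreGNS a)
  rw [ofPreGNS_toPreGNS] at this
  rw [← this, ← Complex.ofReal_pow, Complex.ofReal_re]

omit [StarOrderedRing A] in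
theorem re_nonneg {x : A} (hx : 0 ≤ x) : 0 ≤ (τ x).re := (Complex.nonneg_iff.mp (τ.map_nonneg hx)).1

omit [StarOrderedRing A] in
theorem im_eq_zero {x : A} (hx : 0 ≤ x) : (τ x).im = 0 :=
  (Complex.nonneg_iff.mp (τ.map_nonneg hx)).2.symm

theorem re_mono {x y : A} (h : x ≤ y) : (τ x).re ≤ (τ y).re := by
  have := τ.re_nonneg (sub_nonneg.mpr h)
  rw [map_sub, Complex.sub_re] at this
  linarith

omit [StarOrderedRing A] in
theorem eq_zero_of_re_eq_zero {x : A} (hx : 0 ≤ x) (h : (τ x).re = 0) : τ x = 0 :=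
  Complex.ext h (τ.im_eq_zero hx)

theorem apply_star (x : A) : τ (star x) = star (τ x) := map_star τ x

theorem tendsto_re_apply {x : ℕ → A} {a : A}
    (h : Tendsto (fun n => τ.toPreGNS (x n)) atTop (𝓝 (τ.toPreGNS a))) :
    Tendsto (fun n => (τ (x n)).re) atTop (𝓝 (τ a).re) := by
  have h1 := (tendsto_const_nhds (x := τ.toPreGNS 1)).inner h (𝕜 := ℂ)
  simp only [inner_toPreGNS, star_one, one_mul] at h1
  exact (Complex.continuous_re.tendsto _).comp h1

end general

namespace IsCompleteTrace

variable {τ : A →ₚ[ℂ] ℂ} (hτ : τ.IsCompleteTrace)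
include hτ

theorem apply_mul_nonneg {x c : A} (hx : 0 ≤ x) (hc : 0 ≤ c) : 0 ≤ τ (x * c) := by
  obtain ⟨d, rfl⟩ := CStarAlgebra.nonneg_iff_eq_star_mul_self.mp hc
  rw [← mul_assoc, hτ.map_mul_comm, ← mul_assoc]
  exact τ.map_nonneg (star_right_conjugate_nonneg hx d)

theorem eq_zero_of_nonneg {x : A} (hx : 0 ≤ x) (h : τ x = 0) : x = 0 := by
  obtain ⟨d, rfl⟩ := CStarAlgebra.nonneg_iff_eq_star_mul_self.mp hx
  rw [hτ.faithful d h, mul_zero]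

theorem eq_zero_of_forall {x : A} (h : ∀ y, τ (x * y) = 0) : x = 0 := by
  rw [← star_eq_zero]
  exact hτ.faithful _ (by rw [star_star]; exact h _)

theorem toPreGNS_norm_eq_zero {x : A} (h : ‖τ.toPreGNS x‖ = 0) : x = 0 := by
  apply hτ.faithful
  refine τ.eq_zero_of_re_eq_zero (star_mul_self_nonneg x) ?_
  rw [← norm_toPreGNS_sq, h, zero_pow two_ne_zero]

/-- Testing against the negative part suffices, since τ(a a⁻) = -‖a⁻‖₂² and τ is faithful. -/
theorem nonneg_of_forall_apply_mul {a : A} (ha : IsSelfAdjoint a)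
    (h : ∀ c, 0 ≤ c → 0 ≤ (τ (a * c)).re) : 0 ≤ a := by
  have h1 : a * a⁻ = -(star a⁻ * a⁻) := by
    nth_rw 1 [← CFC.posPart_sub_negPart a]
    rw [sub_mul, CFC.posPart_mul_negPart, zero_sub, (CFC.negPart_nonneg a).isSelfAdjoint.star_eq]
  have h2 := h a⁻ (CFC.negPart_nonneg a)
  rw [h1, map_neg, Complex.neg_re] at h2
  have h3 : a⁻ = 0 := hτ.faithful _ <| τ.eq_zero_of_re_eq_zero (star_mul_self_nonneg _) <|
    le_antisymm (by linarith) (τ.re_nonneg (star_mul_self_nonneg _))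
  rw [← CFC.posPart_sub_negPart a, h3, sub_zero]
  exact CFC.posPart_nonneg a

theorem nonneg_of_tendsto {x : ℕ → A} {a : A} (hx : ∀ n, 0 ≤ x n)
    (h : Tendsto (fun n => τ.toPreGNS (x n)) atTop (𝓝 (τ.toPreGNS a))) : 0 ≤ a := by
  have h1 : ∀ c, Tendsto (fun n => τ (x n * c)) atTop (𝓝 (τ (star a * c))) := fun c => by
    have := h.inner (tendsto_const_nhds (x := τ.toPreGNS c)) (𝕜 := ℂ)
    simpa only [inner_toPreGNS, (hx _).isSelfAdjoint.star_eq] using this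
  have h2 : ∀ c, Tendsto (fun n => τ (x n * c)) atTop (𝓝 (τ (a * c))) := fun c => by
    have := (tendsto_const_nhds (x := τ.toPreGNS (star c))).inner h (𝕜 := ℂ)
    simp only [inner_toPreGNS, star_star] at this
    simpa only [hτ.map_mul_comm c] using this
  -- Since each `x n` is self-adjoint, τ(a⋆c) and τ(ac) are limits of the same sequence.
  have ha : IsSelfAdjoint a := by
    rw [isSelfAdjoint_iff, ← sub_eq_zero]
    refine hτ.eq_zero_of_forall fun c => ?_
    rw [sub_mul, map_sub, tendsto_nhds_unique (h1 c) (h2 c), sub_self]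
  refine hτ.nonneg_of_forall_apply_mul ha fun c hc => ?_
  exact ge_of_tendsto ((Complex.continuous_re.tendsto _).comp (h2 c)) <| .of_forall fun n =>
    (Complex.nonneg_iff.mp (hτ.apply_mul_nonneg (hx n) hc)).1

theorem le_of_tendsto {x : ℕ → A} {a b : A} (hx : ∀ᶠ n in atTop, b ≤ x n)
    (h : Tendsto (fun n => τ.toPreGNS (x n)) atTop (𝓝 (τ.toPreGNS a))) : b ≤ a := by
  obtain ⟨N, hN⟩ := eventually_atTop.mp hx
  rw [← sub_nonneg]
  refine hτ.nonneg_of_tendsto (x := fun n => x (n + N) - b)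
    (fun n => sub_nonneg.mpr (hN _ (by lia))) ?_
  simp only [map_sub]
  exact (h.comp (tendsto_add_atTop_nat N)).sub_const _

theorem ge_of_tendsto {x : ℕ → A} {a b : A} (hx : ∀ᶠ n in atTop, x n ≤ b)
    (h : Tendsto (fun n => τ.toPreGNS (x n)) atTop (𝓝 (τ.toPreGNS a))) : a ≤ b := by
  rw [← neg_le_neg_iff]
  refine hτ.le_of_tendsto (x := fun n => - x n) (hx.mono fun n hn => neg_le_neg hn) ?_
  simp only [map_neg]
  exact h.neg

theorem exists_tendsto {x : ℕ → A} (hx : ∀ n, x n ∈ Icc 0 1)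
    (h : CauchySeq (fun n => τ.toPreGNS (x n))) :
    ∃ a ∈ Icc (0 : A) 1, Tendsto (fun n => τ.toPreGNS (x n)) atTop (𝓝 (τ.toPreGNS a)) := by
  obtain ⟨a, ha⟩ := hτ.complete x hx h
  exact ⟨a, ⟨hτ.le_of_tendsto (.of_forall fun n => (hx n).1) ha,
    hτ.ge_of_tendsto (.of_forall fun n => (hx n).2) ha⟩, ha⟩

/-- Positivity of τ(d(1 - d)). Applied to increments of a monotone sequence, it turns convergence of
the traces into the Cauchy property in the 2-norm. -/
theorem norm_toPreGNS_sq_le {d : A} (hd : d ∈ Icc 0 1) : ‖τ.toPreGNS d‖ ^ 2 ≤ (τ d).re := by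
  have h := (Complex.nonneg_iff.mp (hτ.apply_mul_nonneg hd.1 (sub_nonneg.mpr hd.2))).1
  rw [mul_sub, mul_one, map_sub, Complex.sub_re] at h
  rw [norm_toPreGNS_sq, hd.1.isSelfAdjoint.star_eq]
  linarith

theorem cauchySeq_of_monotone {x : ℕ → A} (hx : ∀ n, x n ∈ Icc 0 1) (hm : Monotone x) :
    CauchySeq (fun n => τ.toPreGNS (x n)) := by
  have hr : Monotone fun n => (τ (x n)).re := fun n m h => τ.re_mono (hm h)
  have hb : BddAbove (range fun n => (τ (x n)).re) :=
    ⟨(τ 1).re, by rintro _ ⟨n, rfl⟩; exact τ.re_mono (hx n).2⟩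
  have hc := (tendsto_atTop_ciSup hr hb).cauchySeq
  rw [Metric.cauchySeq_iff'] at hc ⊢
  intro ε hε
  obtain ⟨N, hN⟩ := hc (ε ^ 2) (by positivity)
  refine ⟨N, fun n hn => ?_⟩
  have h1 := hN n hn
  rw [Real.dist_eq, abs_of_nonneg (sub_nonneg.mpr (hr hn))] at h1
  have h2 := hτ.norm_toPreGNS_sq_le (d := x n - x N)
    ⟨sub_nonneg.mpr (hm hn), (sub_le_self _ (hx N).1).trans (hx n).2⟩
  rw [map_sub, map_sub, Complex.sub_re] at h2
  rw [dist_eq_norm]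
  exact lt_of_pow_lt_pow_left₀ 2 hε.le (h2.trans_lt h1)

/-- The 2-norm limit is the least upper bound, so it depends on the order only and not on the trace.
This lets two different traces be compared on one limit. -/
theorem exists_sup_of_monotone {x : ℕ → A} (hx : ∀ n, x n ∈ Icc 0 1) (hm : Monotone x) :
    ∃ a ∈ Icc (0 : A) 1, (∀ n, x n ≤ a) ∧ (∀ b, (∀ n, x n ≤ b) → a ≤ b) ∧
      Tendsto (fun n => (τ (x n)).re) atTop (𝓝 (τ a).re) := by
  obtain ⟨a, ha, h⟩ := hτ.exists_tendsto hx (hτ.cauchySeq_of_monotone hx hm)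
  exact ⟨a, ha, fun n => hτ.le_of_tendsto (eventually_atTop.mpr ⟨n, fun m hm' => hm hm'⟩) h,
    fun b hb => hτ.ge_of_tendsto (.of_forall hb) h, τ.tendsto_re_apply h⟩

theorem exists_inf_of_antitone {x : ℕ → A} (hx : ∀ n, x n ∈ Icc 0 1) (hm : Antitone x) :
    ∃ a ∈ Icc (0 : A) 1, (∀ n, a ≤ x n) ∧
      Tendsto (fun n => (τ (x n)).re) atTop (𝓝 (τ a).re) := by
  obtain ⟨a, ha, h1, -, h2⟩ := hτ.exists_sup_of_monotone (x := fun n => 1 - x n)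
    (fun n => ⟨sub_nonneg.mpr (hx n).2, sub_le_self _ (hx n).1⟩)
    (fun n m h => sub_le_sub_left (hm h) _)
  refine ⟨1 - a, ⟨sub_nonneg.mpr ha.2, sub_le_self _ ha.1⟩, fun n => ?_, ?_⟩
  · rw [sub_le_comm]
    exact h1 n
  · have := h2.const_sub (τ 1).re
    simpa only [map_sub, Complex.sub_re, sub_sub_cancel] using this

end IsCompleteTrace

/-! ### A bounded operator monotone function -/

/-- The operator monotone function `s ↦ 1 - (1 + s)⁻¹`. -/
def oneSubInv (s : A) : A := 1 - Ring.inverse (1 + s)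

theorem isStrictlyPositive_one_add {s : A} (hs : 0 ≤ s) : IsStrictlyPositive (1 + s) :=
  IsStrictlyPositive.add_nonneg (by simp) hs

/-- Inversion is operator antitone. The function serves to bring increasing sums of positive
elements into [0, 1] while keeping them increasing, which truncation by `min 1` would not. -/
theorem oneSubInv_mono {s t : A} (hs : 0 ≤ s) (h : s ≤ t) : oneSubInv s ≤ oneSubInv t :=
  sub_le_sub_left (CStarAlgebra.ringInverse_le_ringInverse (add_le_add_right h 1)
    (isStrictlyPositive_one_add hs)) _

theorem oneSubInv_eq_cfc {s : A} (hs : 0 ≤ s) :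
    oneSubInv s = cfc (fun t : ℝ => 1 - (1 + t)⁻¹) s := by
  have hsp : ∀ t ∈ spectrum ℝ s, 0 ≤ t := fun t ht => spectrum_nonneg_of_nonneg hs ht
  have hc : ContinuousOn (fun t : ℝ => (1 + t)⁻¹) (spectrum ℝ s) :=
    ContinuousOn.inv₀ (by fun_prop) fun t ht => by have := hsp t ht; positivity
  have h1 : (1 + s) * cfc (fun t : ℝ => (1 + t)⁻¹) s = 1 := by
    have : 1 + s = cfc (fun t : ℝ => 1 + t) s := by
      rw [cfc_const_add (1 : ℝ) (fun t => t) s, cfc_id' ℝ s, map_one]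
    rw [this, ← cfc_mul _ _ s (by fun_prop) hc, ← cfc_one ℝ s]
    refine cfc_congr fun t ht => mul_inv_cancel₀ ?_
    have := hsp t ht
    positivity
  have h2 : Ring.inverse (1 + s) = cfc (fun t : ℝ => (1 + t)⁻¹) s := by
    have h3 := congrArg (Ring.inverse (1 + s) * ·) h1
    simpa only [← mul_assoc, Ring.inverse_mul_cancel _ (isStrictlyPositive_one_add hs).isUnit,
      one_mul, mul_one] using h3.symm
  rw [oneSubInv, h2, cfc_sub _ _ s (by fun_prop) hc, cfc_const_one ℝ s]

theorem oneSubInv_mem {s : A} (hs : 0 ≤ s) : oneSubInv s ∈ Icc (0 : A) 1 := by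
  rw [oneSubInv_eq_cfc hs]
  have hsp : ∀ t ∈ spectrum ℝ s, 0 ≤ t := fun t ht => spectrum_nonneg_of_nonneg hs ht
  refine ⟨cfc_nonneg fun t ht => ?_, cfc_le_one _ _ fun t ht => ?_⟩
  · have := hsp t ht
    rw [sub_nonneg]
    exact inv_le_one_of_one_le₀ (by linarith)
  · have := hsp t ht
    have : 0 ≤ (1 + t)⁻¹ := by positivity
    linarith

theorem oneSubInv_le {s : A} (hs : 0 ≤ s) : oneSubInv s ≤ s := by
  have hsp : ∀ t ∈ spectrum ℝ s, 0 ≤ t := fun t ht => spectrum_nonneg_of_nonneg hs ht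
  have hc : ContinuousOn (fun t : ℝ => 1 - (1 + t)⁻¹) (spectrum ℝ s) :=
    continuousOn_const.sub <|
      ContinuousOn.inv₀ (by fun_prop) fun t ht => by have := hsp t ht; positivity
  rw [oneSubInv_eq_cfc hs]
  conv_rhs => rw [← cfc_id' ℝ s]
  refine cfc_mono (fun t ht => ?_) hc
  have := hsp t ht
  have h1 : 0 < 1 + t := by positivity
  rw [sub_le_iff_le_add, ← sub_le_iff_le_add', inv_eq_one_div, le_div_iff₀ h1]
  nlinarith

/-- The function is t/(1 + t), whose denominator is at most 2 on [0, 1]: elements of [0, 1] keep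
half of their size. -/
theorem half_smul_le_oneSubInv {x : A} (hx : x ∈ Icc 0 1) : (1 / 2 : ℝ) • x ≤ oneSubInv x := by
  have hsp : ∀ t ∈ spectrum ℝ x, 0 ≤ t := fun t ht => spectrum_nonneg_of_nonneg hx.1 ht
  have hsp1 : ∀ t ∈ spectrum ℝ x, t ≤ 1 := (le_algebraMap_iff_spectrum_le
    (a := x) (r := (1 : ℝ)) hx.1.isSelfAdjoint).mp (by simpa using hx.2)
  have hc : ContinuousOn (fun t : ℝ => 1 - (1 + t)⁻¹) (spectrum ℝ x) :=
    continuousOn_const.sub <|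
      ContinuousOn.inv₀ (by fun_prop) fun t ht => by have := hsp t ht; positivity
  rw [oneSubInv_eq_cfc hx.1]
  have : (1 / 2 : ℝ) • x = cfc (fun t : ℝ => (1 / 2 : ℝ) * t) x := by
    rw [cfc_const_mul _ _ x, cfc_id' ℝ x]
  rw [this]
  refine cfc_mono (fun t ht => ?_) (by fun_prop) hc
  have h0 := hsp t ht
  have h1 : 0 < 1 + t := by positivity
  have h2 := hsp1 t ht
  rw [le_sub_comm, inv_eq_one_div, div_le_iff₀ h1]
  nlinarith

end PositiveLinearMap

/-! ### Absolute continuity of one complete trace with respect to another -/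

namespace PositiveLinearMap

variable {A : Type*} [CStarAlgebra A] [PartialOrder A] [StarOrderedRing A]

/-- Borel–Cantelli without commutativity. If τ(x_n) ≤ 2⁻ⁿ but φ(x_n) > ε, let y_n be the supremum of
the partial sums of x_n + x_{n+1} + ⋯, each compressed into [0, 1] by `oneSubInv`. The y_n decrease
and τ(y_n) → 0, so a lower bound z ≥ 0 along which φ(y_n) → φ(z) must vanish; yet y_n ≥ x_n/2 keeps
φ(y_n) ≥ ε/2. -/
theorem IsCompleteTrace.exists_forall_re_le {τ φ : A →ₚ[ℂ] ℂ} (hτ : τ.IsCompleteTrace)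
    (hφ : φ.IsCompleteTrace) {ε : ℝ} (hε : 0 < ε) :
    ∃ δ > 0, ∀ x ∈ Icc (0 : A) 1, (τ x).re ≤ δ → (φ x).re ≤ ε := by
  by_contra! hcon
  choose x hx hτx hφx using fun n : ℕ => hcon ((1 / 2) ^ n) (by positivity)
  let s : ℕ → ℕ → A := fun n N => ∑ m ∈ Finset.range N, x (n + m)
  have hs0 : ∀ n N, 0 ≤ s n N := fun n N => Finset.sum_nonneg fun m _ => (hx _).1
  have hsm : ∀ n, Monotone (s n) := fun n => monotone_nat_of_le_succ fun N => by
    simp only [s, Finset.sum_range_succ]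
    exact le_add_of_nonneg_right (hx _).1
  have hss : ∀ n N, s (n + 1) N ≤ s n (N + 1) := fun n N => by
    simp only [s, Finset.sum_range_succ' _ N, add_zero]
    refine le_add_of_le_of_nonneg (Finset.sum_le_sum fun m _ => ?_) (hx _).1
    rw [add_assoc, add_comm 1 m]
  choose y hy hyle hylub hyt using fun n =>
    hτ.exists_sup_of_monotone (x := fun N => oneSubInv (s n N))
      (fun N => oneSubInv_mem (hs0 n N)) (fun N N' h => oneSubInv_mono (hs0 _ _) (hsm n h))
  -- Only the least-upper-bound property of `y (n + 1)` is used: the tail sums from n + 1 are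
  -- dominated by those from n with one more term.
  have hya : Antitone y := antitone_nat_of_succ_le fun n => hylub _ _ fun N =>
    (oneSubInv_mono (hs0 _ _) (hss n N)).trans (hyle n (N + 1))
  have hτy : ∀ n, (τ (y n)).re ≤ 2 * (1 / 2) ^ n := fun n => by
    refine le_of_tendsto' (hyt n) fun N => (τ.re_mono (oneSubInv_le (hs0 n N))).trans ?_
    simp only [s, map_sum, Complex.re_sum]
    calc _ ≤ ∑ m ∈ Finset.range N, (1 / 2 : ℝ) ^ n * (1 / 2) ^ m :=
          Finset.sum_le_sum fun m _ => by rw [← pow_add]; exact hτx _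
      _ ≤ (1 / 2 : ℝ) ^ n * 2 := by
          rw [← Finset.mul_sum]
          gcongr
          exact (summable_geometric_two.sum_le_tsum _ fun _ _ => by positivity).trans_eq
            tsum_geometric_two
      _ = _ := mul_comm _ _
  obtain ⟨z, hz, hzy, hzt⟩ := hφ.exists_inf_of_antitone hy hya
  have hz0 : z = 0 := by
    refine hτ.eq_zero_of_nonneg hz.1 (τ.eq_zero_of_re_eq_zero hz.1
      (le_antisymm ?_ (τ.re_nonneg hz.1)))
    have h2 : Tendsto (fun n : ℕ => 2 * (1 / 2 : ℝ) ^ n) atTop (𝓝 (2 * 0)) :=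
      (tendsto_pow_atTop_nhds_zero_of_lt_one (by norm_num) (by norm_num)).const_mul 2
    rw [mul_zero] at h2
    exact _root_.ge_of_tendsto' h2 fun n => (τ.re_mono (hzy n)).trans (hτy n)
  rw [hz0, map_zero, Complex.zero_re] at hzt
  have hge : ∀ n, ε / 2 ≤ (φ (y n)).re := fun n => by
    have h1 : (1 / 2 : ℝ) • x n ≤ y n := by
      refine (half_smul_le_oneSubInv (hx n)).trans ?_
      have := hyle n 1
      simpa [s] using this
    have h2 := φ.re_mono h1
    rw [map_smul_of_tower, Complex.real_smul, Complex.re_ofReal_mul] at h2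
    linarith [hφx n]
  linarith [_root_.ge_of_tendsto' hzt hge]

/-! ### A Radon–Nikodym theorem -/

/-- An element of `[0, 1]` that almost supports the positive part of a self-adjoint element. -/
theorem exists_le_sub_mul_mem_Icc {y : A} (hy : IsSelfAdjoint y) {ε : ℝ} (hε : 0 < ε) :
    ∃ p : A, 0 ≤ p ∧ y ≤ p ∧ ∃ x ∈ Icc (0 : A) 1, p - algebraMap ℝ A ε ≤ y * x := by
  -- A continuous substitute for the indicator of (0, ∞): t f(t) differs from max(t, 0) only for 0 <
  -- t < ε, and there by at most ε.
  let f : ℝ → ℝ := fun t => min 1 (ε⁻¹ * max t 0)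
  have hf : Continuous f := by fun_prop
  refine ⟨cfc (fun t : ℝ => max t 0) y, cfc_nonneg fun t _ => le_max_right _ _, ?_,
    cfc f y, ⟨cfc_nonneg fun t _ => ?_, cfc_le_one _ _ fun t _ => min_le_left _ _⟩, ?_⟩
  · conv_lhs => rw [← cfc_id' ℝ y]
    exact cfc_mono fun t _ => le_max_left _ _
  · exact le_min zero_le_one (mul_nonneg (inv_nonneg.mpr hε.le) (le_max_right _ _))
  · have h1 : y * cfc f y = cfc (fun t => t * f t) y := by
      rw [cfc_mul _ _ y, cfc_id' ℝ y]
    rw [h1, ← cfc_const ε y, ← cfc_sub _ _ y]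
    refine cfc_mono fun t _ => ?_
    simp only [f]
    rcases le_total t 0 with ht | ht
    · simp [max_eq_right ht, hε.le]
    · rw [max_eq_left ht]
      rcases le_total 1 (ε⁻¹ * t) with h | h
      · rw [min_eq_left h]; linarith
      · rw [min_eq_right h]
        have : t ≤ ε := by rwa [inv_mul_le_iff₀ hε, mul_one] at h
        have : 0 ≤ t * (ε⁻¹ * t) := by positivity
        linarith

theorem IsCompleteTrace.isClosed_image_Icc {ψ : A →ₚ[ℂ] ℂ} (hψ : ψ.IsCompleteTrace) :
    IsClosed ((fun x : A => (ψ.toPreGNS x : ψ.GNS)) '' Icc 0 1) := by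
  rw [← isSeqClosed_iff_isClosed]
  intro ξ η hξ h
  choose x hx hxξ using hξ
  obtain rfl : (fun n => (ψ.toPreGNS (x n) : ψ.GNS)) = ξ := funext hxξ
  have hc : CauchySeq fun n => ψ.toPreGNS (x n) :=
    (UniformSpace.Completion.isUniformInducing_coe _).cauchy_map_iff.mp h.cauchySeq
  obtain ⟨a, ha, hat⟩ := hψ.exists_tendsto hx hc
  exact ⟨a, ha, tendsto_nhds_unique
    (((UniformSpace.Completion.continuous_coe _).tendsto _).comp hat) h⟩

theorem convex_image_Icc (ψ : A →ₚ[ℂ] ℂ) :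
    Convex ℝ ((fun x : A => (ψ.toPreGNS x : ψ.GNS)) '' Icc 0 1) := by
  rintro _ ⟨x, hx, rfl⟩ _ ⟨y, hy, rfl⟩ a b ha hb hab
  refine ⟨a • x + b • y, convex_Icc (𝕜 := ℝ) (0 : A) 1 hx hy ha hb hab, ?_⟩
  have h : ∀ (c : ℝ) (z : A), ψ.toPreGNS (c • z) = (c : ℂ) • ψ.toPreGNS z := fun c z => by
    rw [← map_smul, Complex.coe_smul]
  simp only [map_add, h, UniformSpace.Completion.coe_add, UniformSpace.Completion.coe_smul,
    Complex.coe_smul]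

/-- A Radon–Nikodym theorem: a vector of the GNS space that defines a functional between `0` and
`ψ` lies in the image of `[0, 1]`. -/
theorem IsCompleteTrace.exists_eq_toPreGNS {ψ : A →ₚ[ℂ] ℂ} (hψ : ψ.IsCompleteTrace) (ξ : ψ.GNS)
    (h0 : ∀ a : A, 0 ≤ a → 0 ≤ ⟪ξ, (ψ.toPreGNS a : ψ.GNS)⟫_ℂ)
    (h1 : ∀ a : A, 0 ≤ a → ⟪ξ, (ψ.toPreGNS a : ψ.GNS)⟫_ℂ ≤ ψ a) :
    ∃ k ∈ Icc (0 : A) 1, (ψ.toPreGNS k : ψ.GNS) = ξ := by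
  by_contra hcon
  have hsa : ∀ a : A, ⟪ξ, (ψ.toPreGNS (star a) : ψ.GNS)⟫_ℂ =
      star ⟪ξ, (ψ.toPreGNS a : ψ.GNS)⟫_ℂ := by
    let φ : A →ₚ[ℂ] ℂ := PositiveLinearMap.mk₀
      ((innerSL ℂ ξ).toLinearMap ∘ₗ (UniformSpace.Completion.toComplL (𝕜 := ℂ)).toLinearMap ∘ₗ
        ψ.toPreGNS.toLinearMap) h0
    exact fun a => φ.apply_star a
  -- The image of [0, 1] is convex and closed, so a vector ξ outside it is strictly separated from
  -- it, with gap d. Approximating the separating functional by an element z of the algebra, the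
  -- inequalities ⟨ξ, z⟩ ≤ ⟨ξ, p⟩ ≤ ψ(p) ≤ ψ(zx) + ε ψ(1) for p ≥ z₊-like and x ∈ [0, 1] contradict
  -- the gap.
  obtain ⟨f, u, hf1, hf2⟩ := RCLike.geometric_hahn_banach_closed_point (𝕜 := ℂ)
    (convex_image_Icc ψ) hψ.isClosed_image_Icc hcon
  set η := (InnerProductSpace.toDual ℂ ψ.GNS).symm f with hη
  have hf : ∀ ζ, f ζ = ⟪η, ζ⟫_ℂ := fun ζ => (InnerProductSpace.toDual_symm_apply).symm
  simp only [hf] at hf1 hf2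
  obtain ⟨B, hB0, hB1, hBξ⟩ : ∃ B > 0, ‖ψ.toPreGNS (1 : A)‖ ≤ B ∧ ‖ξ‖ ≤ B :=
    ⟨max 1 (max ‖ψ.toPreGNS (1 : A)‖ ‖ξ‖), by positivity, by simp, by simp⟩
  have hBx : ∀ x ∈ Icc (0 : A) 1, ‖(ψ.toPreGNS x : ψ.GNS)‖ ≤ B := fun x hx => by
    rw [UniformSpace.Completion.norm_coe]
    refine le_trans (le_of_sq_le_sq ?_ (norm_nonneg _)) hB1
    refine (hψ.norm_toPreGNS_sq_le hx).trans ?_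
    rw [norm_toPreGNS_sq, star_one, one_mul]
    exact ψ.re_mono hx.2
  set d := RCLike.re ⟪η, ξ⟫_ℂ - u with hd
  have hd0 : 0 < d := by rw [hd]; linarith
  -- The radius makes the error at most d/4 on vectors of norm at most B. The total error is 3d/4:
  -- two such approximations, at x and at ξ, and ε ψ(1) ≤ d/4.
  obtain ⟨_, hy, ⟨y', rfl⟩⟩ := Metric.dense_iff.mp
    (UniformSpace.Completion.denseRange_coe (α := ψ.PreGNS)) η (d / (4 * B)) (by positivity)
  obtain ⟨y, rfl⟩ := ψ.toPreGNS.surjective y'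
  rw [Metric.mem_ball, dist_eq_norm] at hy
  have happ : ∀ ζ : ψ.GNS, ‖ζ‖ ≤ B →
      |(⟪(ψ.toPreGNS y : ψ.GNS), ζ⟫_ℂ).re - (⟪η, ζ⟫_ℂ).re| ≤ d / 4 := fun ζ hζ => by
    rw [← Complex.sub_re, ← inner_sub_left]
    refine (Complex.abs_re_le_norm _).trans ((norm_inner_le_norm _ _).trans ?_)
    calc _ ≤ d / (4 * B) * B := by gcongr
      _ = d / 4 := by field_simp
  -- replace `y` by its real part
  set z : A := (1 / 2 : ℝ) • (y + star y) with hz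
  have hzsa : IsSelfAdjoint z := by
    rw [hz, isSelfAdjoint_iff, star_smul, star_add, star_star, add_comm, star_trivial]
  have hzx : ∀ x : A, 0 ≤ x →
      (⟪(ψ.toPreGNS y : ψ.GNS), (ψ.toPreGNS x : ψ.GNS)⟫_ℂ).re = (ψ (z * x)).re := fun x hx => by
    rw [UniformSpace.Completion.inner_coe, inner_toPreGNS, hz, smul_mul_assoc,
      map_smul_of_tower, add_mul, map_add, Complex.real_smul, Complex.re_ofReal_mul,
      Complex.add_re]
    have : ψ (y * x) = star (ψ (star y * x)) := by
      rw [← apply_star, star_mul, star_star, hx.isSelfAdjoint.star_eq, hψ.map_mul_comm]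
    rw [this, Complex.star_def, Complex.conj_re]
    ring
  have hzξ : (⟪(ψ.toPreGNS y : ψ.GNS), ξ⟫_ℂ).re = (⟪ξ, (ψ.toPreGNS z : ψ.GNS)⟫_ℂ).re := by
    have h2 : ⟪ξ, (ψ.toPreGNS z : ψ.GNS)⟫_ℂ = (1 / 2 : ℂ) * (⟪ξ, (ψ.toPreGNS y : ψ.GNS)⟫_ℂ +
        star ⟪ξ, (ψ.toPreGNS y : ψ.GNS)⟫_ℂ) := by
      have : z = (1 / 2 : ℂ) • (y + star y) := by
        rw [hz, ← Complex.coe_smul]; norm_num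
      rw [this, map_smul, UniformSpace.Completion.coe_smul, inner_smul_right, map_add,
        UniformSpace.Completion.coe_add, inner_add_right, hsa]
    have h3 : (⟪(ψ.toPreGNS y : ψ.GNS), ξ⟫_ℂ).re = (⟪ξ, (ψ.toPreGNS y : ψ.GNS)⟫_ℂ).re := by
      rw [← inner_conj_symm, Complex.conj_re]
    rw [h2]
    simp
    rw [h3]
    ring
  obtain ⟨ε, hε, hεψ⟩ : ∃ ε > 0, ε * (ψ 1).re ≤ d / 4 := by
    have h3 : 0 ≤ (ψ 1).re := ψ.re_nonneg zero_le_one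
    refine ⟨d / (4 * ((ψ 1).re + 1)), by positivity, ?_⟩
    rw [div_mul_eq_mul_div, div_le_div_iff₀ (by positivity) (by positivity)]
    nlinarith
  obtain ⟨p, hp0, hzp, x, hx, hpx⟩ := exists_le_sub_mul_mem_Icc hzsa hε
  have e1 := hf1 _ ⟨x, hx, rfl⟩
  have e2 := (abs_le.mp (happ _ (hBx x hx))).2
  rw [hzx x hx.1] at e2
  have e3 := (abs_le.mp (happ ξ hBξ)).1
  rw [hzξ] at e3
  have e4 := ψ.re_mono hpx
  rw [map_sub, Complex.sub_re, Algebra.algebraMap_eq_smul_one, map_smul_of_tower,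
    Complex.real_smul, Complex.re_ofReal_mul] at e4
  have e5 : (⟪ξ, (ψ.toPreGNS z : ψ.GNS)⟫_ℂ).re ≤ (⟪ξ, (ψ.toPreGNS p : ψ.GNS)⟫_ℂ).re := by
    have := (Complex.nonneg_iff.mp (h0 _ (sub_nonneg.mpr hzp))).1
    rw [map_sub, UniformSpace.Completion.coe_sub, inner_sub_right, Complex.sub_re] at this
    linarith
  have e6 := (Complex.le_def.mp (h1 p hp0)).1
  simp only [RCLike.re_to_complex] at e1 hd
  linarith

end PositiveLinearMap

/-! ### The commutation theorem on the GNS space -/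

namespace PositiveLinearMap

variable {A : Type*} [CStarAlgebra A] [PartialOrder A] [StarOrderedRing A]

theorem gns_ext {τ : A →ₚ[ℂ] ℂ} {E : Type*} [NormedAddCommGroup E] [NormedSpace ℂ E]
    {S T : τ.GNS →L[ℂ] E} (h : ∀ a : A, S (τ.toPreGNS a) = T (τ.toPreGNS a)) : S = T := by
  ext ξ
  induction ξ using UniformSpace.Completion.induction_on with
  | hp => exact isClosed_eq S.continuous T.continuous
  | ih a => exact h a

theorem gnsStarAlgHom_coe (τ : A →ₚ[ℂ] ℂ) (a b : A) :
    τ.gnsStarAlgHom a (τ.toPreGNS b) = τ.toPreGNS (a * b) :=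
  τ.gnsNonUnitalStarAlgHom_apply_coe

/-- A self-adjoint element is an affine image of an element of `[0, 1]`. -/
theorem exists_smul_add_mem_Icc {S : A} (hS : IsSelfAdjoint S) :
    ∃ c r d : ℂ, c • (S + r • 1) ∈ Icc (0 : A) 1 ∧ S = d • c • (S + r • 1) - r • 1 := by
  obtain ⟨c, hc0, hc⟩ : ∃ c : ℝ, 0 < c ∧ ‖S‖ ≤ c := ⟨‖S‖ + 1, by positivity, by linarith⟩
  have hn : algebraMap ℝ A ‖S‖ ≤ c • 1 := by
    rw [Algebra.algebraMap_eq_smul_one]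
    exact smul_le_smul_of_nonneg_right hc zero_le_one
  have h1 : S ≤ c • 1 := hS.le_algebraMap_norm_self.trans hn
  have h2 : -(c • 1) ≤ S := (neg_le_neg hn).trans hS.neg_algebraMap_norm_le_self
  refine ⟨((2 * c)⁻¹ : ℝ), c, ((2 * c : ℝ)), ?_, ?_⟩
  · rw [Complex.coe_smul, Complex.coe_smul]
    refine ⟨smul_nonneg (by positivity) (neg_le_iff_add_nonneg.mp h2), ?_⟩
    have h3 : S + c • 1 ≤ (2 * c) • 1 := by
      rw [two_mul, add_smul]
      exact add_le_add_left h1 _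
    refine (smul_le_smul_of_nonneg_left h3 (by positivity)).trans_eq ?_
    rw [smul_smul, inv_mul_cancel₀ (by positivity), one_smul]
  · rw [smul_smul, ← Complex.ofReal_mul, mul_inv_cancel₀ (by positivity), Complex.ofReal_one,
      one_smul, add_sub_cancel_right]

namespace IsCompleteTrace

variable {τ : A →ₚ[ℂ] ℂ} (hτ : τ.IsCompleteTrace)

theorem gnsStarAlgHom_injective (hτ : τ.IsCompleteTrace) : Function.Injective τ.gnsStarAlgHom := by
  rw [injective_iff_map_eq_zero]
  intro a ha
  have h := congrArg (fun T => ‖T (τ.toPreGNS 1 : τ.GNS)‖) ha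
  simp only [gnsStarAlgHom_coe, mul_one, UniformSpace.Completion.norm_coe,
    _root_.zero_apply, norm_zero] at h
  exact hτ.toPreGNS_norm_eq_zero h

/-- Right multiplication on the pre-GNS space of a trace. -/
def rightMulPreGNS (hτ : τ.IsCompleteTrace) (b : A) : τ.PreGNS →L[ℂ] τ.PreGNS :=
  LinearMap.mkContinuous (τ.toPreGNS.toLinearMap ∘ₗ LinearMap.mulRight ℂ b ∘ₗ
    τ.ofPreGNS.toLinearMap) ‖b‖ fun x => by
    obtain ⟨x, rfl⟩ := τ.toPreGNS.surjective x
    refine le_of_sq_le_sq ?_ (by positivity)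
    change ‖τ.toPreGNS (x * b)‖ ^ 2 ≤ _
    -- The trace property turns ‖xb‖₂² into τ(x b b⋆ x⋆), where b b⋆ ≤ ‖b‖² can be used.
    rw [mul_pow, norm_toPreGNS_sq, norm_toPreGNS_sq, hτ.map_mul_comm, hτ.map_mul_comm (star x)]
    have h : x * b * star (x * b) ≤ (‖b‖ ^ 2 : ℝ) • (x * star x) := by
      have := CStarAlgebra.star_right_conjugate_le_norm_smul (a := x) (b := b * star b)
      rwa [CStarRing.norm_self_mul_star, ← sq, mul_assoc, mul_assoc, ← star_mul,
        ← mul_assoc] at this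
    refine (τ.re_mono h).trans_eq ?_
    rw [map_smul_of_tower, Complex.real_smul, Complex.re_ofReal_mul]

/-- Right multiplication by `b` on the GNS space of a trace. -/
def rightMul (b : A) : τ.GNS →L[ℂ] τ.GNS := (hτ.rightMulPreGNS b).completion

theorem rightMul_coe (b a : A) : hτ.rightMul b (τ.toPreGNS a) = τ.toPreGNS (a * b) := by
  rw [rightMul, ContinuousLinearMap.completion_apply_coe]
  rfl

theorem adjoint_rightMul (b : A) : star (hτ.rightMul b) = hτ.rightMul (star b) := by
  rw [ContinuousLinearMap.star_eq_adjoint]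
  symm
  rw [ContinuousLinearMap.eq_adjoint_iff]
  intro x y
  induction x, y using UniformSpace.Completion.induction_on₂ with
  | hp => apply isClosed_eq <;> fun_prop
  | ih x y =>
    obtain ⟨x, rfl⟩ := τ.toPreGNS.surjective x
    obtain ⟨y, rfl⟩ := τ.toPreGNS.surjective y
    rw [rightMul_coe, rightMul_coe, UniformSpace.Completion.inner_coe,
      UniformSpace.Completion.inner_coe, inner_toPreGNS, inner_toPreGNS, star_mul, star_star,
      mul_assoc, hτ.map_mul_comm, mul_assoc]

theorem commute_gnsStarAlgHom_rightMul (a b : A) :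
    Commute (τ.gnsStarAlgHom a) (hτ.rightMul b) :=
  gns_ext fun c => by
    simp only [mul_apply_eq_comp, gnsStarAlgHom_coe, rightMul_coe, mul_assoc]

/-- Since T commutes with right multiplication, ⟨T1, d⋆d⟩ = ⟨T d⋆, d⋆⟩, which lies between 0 and
τ(d⋆d). The Radon–Nikodym theorem therefore gives k with T1 = k, and then Ta = (T1)a = ka. -/
theorem exists_gnsStarAlgHom_eq_of_nonneg {T : τ.GNS →L[ℂ] τ.GNS}
    (hT : ∀ b, Commute T (hτ.rightMul b)) (h0 : 0 ≤ T) (h1 : T ≤ 1) :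
    ∃ a, τ.gnsStarAlgHom a = T := by
  have key : ∀ d : A, ⟪T (τ.toPreGNS 1), (τ.toPreGNS (star d * d) : τ.GNS)⟫_ℂ =
      ⟪T (τ.toPreGNS (star d)), (τ.toPreGNS (star d) : τ.GNS)⟫_ℂ := fun d => by
    rw [← rightMul_coe hτ, ← star_star (hτ.rightMul d), adjoint_rightMul,
      ContinuousLinearMap.star_eq_adjoint, ContinuousLinearMap.adjoint_inner_right]
    have := congrArg (fun S => S (τ.toPreGNS 1 : τ.GNS)) (hT (star d)).eq
    simp only [mul_apply_eq_comp, rightMul_coe, one_mul] at this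
    rw [this]
  obtain ⟨k, -, hk⟩ := hτ.exists_eq_toPreGNS (T (τ.toPreGNS 1)) (fun a ha => by
    obtain ⟨d, rfl⟩ := CStarAlgebra.nonneg_iff_eq_star_mul_self.mp ha
    rw [key]
    exact ((ContinuousLinearMap.nonneg_iff_isPositive T).mp h0).inner_nonneg_left _) (fun a ha => by
    obtain ⟨d, rfl⟩ := CStarAlgebra.nonneg_iff_eq_star_mul_self.mp ha
    have h2 := ((ContinuousLinearMap.le_def T 1).mp h1).inner_nonneg_left (τ.toPreGNS (star d))
    rw [_root_.sub_apply, inner_sub_left, one_apply_eq_self,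
      UniformSpace.Completion.inner_coe, inner_toPreGNS, star_star, sub_nonneg,
      hτ.map_mul_comm] at h2
    rwa [key])
  refine ⟨k, gns_ext fun a => ?_⟩
  have := congrArg (fun S => S (τ.toPreGNS 1 : τ.GNS)) (hT a).eq
  simp only [mul_apply_eq_comp, rightMul_coe, one_mul, ← hk] at this
  rw [gnsStarAlgHom_coe, this]

/-- The commutation theorem for a complete trace: the commutant of the right multiplications
consists of left multiplications. -/
theorem exists_gnsStarAlgHom_eq {T : τ.GNS →L[ℂ] τ.GNS}
    (hT : ∀ b, Commute T (hτ.rightMul b)) : ∃ a, τ.gnsStarAlgHom a = T := by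
  have hsa : ∀ S : τ.GNS →L[ℂ] τ.GNS, IsSelfAdjoint S → (∀ b, Commute S (hτ.rightMul b)) →
      ∃ a, τ.gnsStarAlgHom a = S := fun S hS hc => by
    obtain ⟨c, r, d, h, hS'⟩ := exists_smul_add_mem_Icc hS
    obtain ⟨a, ha⟩ := hτ.exists_gnsStarAlgHom_eq_of_nonneg (T := c • (S + r • 1))
      (fun b => ((hc b).add_left ((Commute.one_left _).smul_left _)).smul_left _) h.1 h.2
    refine ⟨d • a - r • 1, ?_⟩
    rw [map_sub, map_smul, map_smul, map_one, ha, ← hS']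
  have hT' : ∀ b, Commute (star T) (hτ.rightMul b) := fun b => by
    have := (hT (star b)).star_star
    rwa [adjoint_rightMul, star_star] at this
  -- Real and imaginary parts of T; the commutant of the right multiplications is closed under
  -- adjoints.
  obtain ⟨a, ha⟩ := hsa (T + star T) (IsSelfAdjoint.add_star_self T)
    fun b => (hT b).add_left (hT' b)
  obtain ⟨b, hb⟩ := hsa (Complex.I • (T - star T))
    (by rw [isSelfAdjoint_iff, star_smul, star_sub, star_star, Complex.star_def, Complex.conj_I,
      neg_smul, ← smul_neg, neg_sub])
    fun b => ((hT b).sub_left (hT' b)).smul_left _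
  refine ⟨(1 / 2 : ℂ) • (a - Complex.I • b), ?_⟩
  rw [map_smul, map_sub, map_smul, ha, hb, smul_smul, Complex.I_mul_I, neg_one_smul,
    sub_neg_eq_add, add_add_sub_cancel, ← two_smul ℂ T, smul_smul]
  norm_num

end IsCompleteTrace

/-! ### Sums and uniqueness of complete traces -/

/-- The limit a is found for τ alone; absolute continuity of φ, applied to |x_n - a|², shows that it
is also the limit for φ. -/
theorem IsCompleteTrace.add {τ φ : A →ₚ[ℂ] ℂ} (hτ : τ.IsCompleteTrace) (hφ : φ.IsCompleteTrace) :
    (τ + φ).IsCompleteTrace where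
  map_mul_comm x y := by
    rw [add_apply, add_apply, hτ.map_mul_comm, hφ.map_mul_comm]
  faithful x hx := by
    have h1 := τ.re_nonneg (star_mul_self_nonneg x)
    have h2 := φ.re_nonneg (star_mul_self_nonneg x)
    rw [add_apply] at hx
    have h3 := congrArg Complex.re hx
    rw [Complex.add_re, Complex.zero_re] at h3
    exact hτ.faithful x (τ.eq_zero_of_re_eq_zero (star_mul_self_nonneg x) (by linarith))
  complete x hx hc := by
    have hnorm : ∀ a : A, ‖(τ + φ).toPreGNS a‖ ^ 2 = ‖τ.toPreGNS a‖ ^ 2 + ‖φ.toPreGNS a‖ ^ 2 :=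
      fun a => by simp only [norm_toPreGNS_sq, add_apply, Complex.add_re]
    have hle : ∀ a : A, ‖τ.toPreGNS a‖ ≤ ‖(τ + φ).toPreGNS a‖ := fun a =>
      le_of_sq_le_sq (by rw [hnorm]; linarith [sq_nonneg ‖φ.toPreGNS a‖]) (norm_nonneg _)
    have hcτ : CauchySeq fun n => τ.toPreGNS (x n) := by
      rw [Metric.cauchySeq_iff'] at hc ⊢
      intro ε hε
      obtain ⟨N, hN⟩ := hc ε hε
      refine ⟨N, fun n hn => lt_of_le_of_lt ?_ (hN n hn)⟩
      rw [dist_eq_norm, dist_eq_norm, ← map_sub, ← map_sub]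
      exact hle _
    obtain ⟨a, ha, hat⟩ := hτ.exists_tendsto hx hcτ
    refine ⟨a, ?_⟩
    rw [tendsto_iff_norm_sub_tendsto_zero] at hat ⊢
    have hat2 : Tendsto (fun n => ‖τ.toPreGNS (x n - a)‖ ^ 2) atTop (𝓝 0) := by
      simpa using hat.pow 2
    have hφ2 : Tendsto (fun n => ‖φ.toPreGNS (x n - a)‖ ^ 2) atTop (𝓝 0) := by
      rw [Metric.tendsto_atTop] at hat2 ⊢
      intro ε hε
      -- As ‖x_n - a‖ ≤ 2, it is |x_n - a|²/4 that lies in [0, 1]; undoing the factor 4 leaves ε/2 <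
      -- ε.
      obtain ⟨δ, hδ, H⟩ := hτ.exists_forall_re_le hφ (ε := ε / 8) (by positivity)
      obtain ⟨N, hN⟩ := hat2 (4 * δ) (by positivity)
      refine ⟨N, fun n hn => ?_⟩
      have h1 := hN n hn
      rw [Real.dist_eq, sub_zero, abs_of_nonneg (by positivity), norm_toPreGNS_sq] at h1 ⊢
      set e := star (x n - a) * (x n - a) with he
      have he0 : 0 ≤ e := star_mul_self_nonneg _
      have hr : ∀ σ : A →ₚ[ℂ] ℂ, (σ ((1 / 4 : ℝ) • e)).re = 1 / 4 * (σ e).re := fun σ => by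
        rw [map_smul_of_tower, Complex.real_smul, Complex.re_ofReal_mul]
      have he1 : (1 / 4 : ℝ) • e ∈ Icc (0 : A) 1 := by
        have h0 : (0 : A) ≤ (1 / 4 : ℝ) • e := smul_nonneg (by norm_num) he0
        refine ⟨h0, (CStarAlgebra.norm_le_one_iff_of_nonneg _ h0).mp ?_⟩
        have hxa : ‖x n - a‖ ≤ 2 := by
          have hx1 := (CStarAlgebra.norm_le_one_iff_of_nonneg (x n) (hx n).1).mpr (hx n).2
          have ha1 := (CStarAlgebra.norm_le_one_iff_of_nonneg a ha.1).mpr ha.2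
          linarith [norm_sub_le (x n) a]
        rw [norm_smul, he, CStarRing.norm_star_mul_self, Real.norm_of_nonneg (by norm_num)]
        nlinarith [norm_nonneg (x n - a)]
      have h2 := H _ he1 (by rw [hr]; linarith)
      rw [hr] at h2
      linarith
    have h3 := hat2.add hφ2
    rw [add_zero] at h3
    have h4 := h3.sqrt
    simp only [← hnorm, Real.sqrt_zero, Real.sqrt_sq (norm_nonneg _)] at h4
    simpa only [map_sub] using h4

/-- Uniqueness of the trace. -/
theorem IsCompleteTrace.eq_of_center_trivial {τ φ : A →ₚ[ℂ] ℂ} (hτ : τ.IsCompleteTrace)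
    (hφ : φ.IsCompleteTrace) (hZ : ∀ z : A, (∀ x, z * x = x * z) → ∃ c : ℂ, z = c • 1)
    (h1 : τ 1 = φ 1) (h0 : τ 1 ≠ 0) : τ = φ := by
  have hψ := hτ.add hφ
  set ψ := τ + φ with hψdef
  have hnorm : ∀ a : A, ‖τ.toPreGNS a‖ ≤ ‖ψ.toPreGNS a‖ := fun a => by
    refine le_of_sq_le_sq ?_ (norm_nonneg _)
    rw [norm_toPreGNS_sq, norm_toPreGNS_sq, hψdef, add_apply, Complex.add_re]
    linarith [φ.re_nonneg (star_mul_self_nonneg a)]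
  -- τ is bounded for the 2-norm of ψ = τ + φ by Cauchy–Schwarz, so it is given by a vector of
  -- L²(ψ), and this vector is an element k of [0, 1].
  let f₀ : ψ.PreGNS →L[ℂ] ℂ := LinearMap.mkContinuous
    (τ.toLinearMap ∘ₗ ψ.ofPreGNS.toLinearMap) ‖τ.toPreGNS 1‖ fun x => by
      obtain ⟨x, rfl⟩ := ψ.toPreGNS.surjective x
      have h2 := norm_inner_le_norm (𝕜 := ℂ) (τ.toPreGNS 1) (τ.toPreGNS x)
      rw [inner_toPreGNS, star_one, one_mul] at h2
      exact h2.trans (mul_le_mul_of_nonneg_left (hnorm x) (norm_nonneg _))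
  let f : ψ.GNS →L[ℂ] ℂ := f₀.extend UniformSpace.Completion.toComplL
  have hf : ∀ a : A, f (ψ.toPreGNS a) = τ a := fun a =>
    ContinuousLinearMap.extend_eq f₀ UniformSpace.Completion.denseRange_coe
      (UniformSpace.Completion.isUniformInducing_coe _) (ψ.toPreGNS a)
  have hξ : ∀ a : A, ⟪(InnerProductSpace.toDual ℂ ψ.GNS).symm f, (ψ.toPreGNS a : ψ.GNS)⟫_ℂ = τ a :=
    fun a => by rw [InnerProductSpace.toDual_symm_apply, hf]
  obtain ⟨k, hk, hkξ⟩ := hψ.exists_eq_toPreGNS ((InnerProductSpace.toDual ℂ ψ.GNS).symm f)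
    (fun a ha => by rw [hξ]; exact τ.map_nonneg ha)
    (fun a ha => by
      rw [hξ, hψdef, add_apply]
      exact le_add_of_nonneg_right (φ.map_nonneg ha))
  have hkτ : ∀ a, τ a = ψ (k * a) := fun a => by
    rw [← hξ, ← hkξ, UniformSpace.Completion.inner_coe, inner_toPreGNS,
      hk.1.isSelfAdjoint.star_eq]
  -- The density is central: ψ(kyz) = τ(yz) = τ(zy) = ψ(kzy) = ψ(ykz) for all z.
  obtain ⟨c, rfl⟩ := hZ k fun y => by
    rw [← sub_eq_zero]
    refine hψ.eq_zero_of_forall fun z => ?_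
    rw [sub_mul, map_sub, mul_assoc, ← hkτ, mul_assoc, hψ.map_mul_comm y, mul_assoc, ← hkτ,
      hτ.map_mul_comm, sub_self]
  have hc : ∀ a, τ a = c * (τ a + φ a) := fun a => by
    conv_lhs => rw [hkτ, smul_mul_assoc, one_mul, map_smul, smul_eq_mul, hψdef, add_apply]
  have hc2 : c = 1 / 2 := by
    have := hc 1
    rw [← h1] at this
    field_simp at this ⊢
    linear_combination -this
  ext a
  have := hc a
  rw [hc2] at this
  linear_combination 2 * this

end PositiveLinearMap

/-! ### Faithful normal traces are complete -/

/-- A bounded sequence of operators that is pointwise Cauchy on a dense set is pointwise Cauchy. -/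
theorem ContinuousLinearMap.cauchySeq_apply_of_dense {E : Type*} [NormedAddCommGroup E]
    [NormedSpace ℂ E] {T : ℕ → E →L[ℂ] E} {C : ℝ} (hT : ∀ n, ‖T n‖ ≤ C) {s : Set E}
    (hs : ∀ η ∈ s, CauchySeq fun n => T n η)
    (hd : (Submodule.span ℂ s).topologicalClosure = ⊤) (η : E) : CauchySeq fun n => T n η := by
  have hspan : ∀ η ∈ Submodule.span ℂ s, CauchySeq fun n => T n η := fun η hη => by
    induction hη using Submodule.span_induction with
    | mem x hx => exact hs x hx
    | zero => simpa using cauchySeq_const (0 : E)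
    | add x y _ _ hx hy => simp only [map_add]; exact hx.add hy
    | smul c x _ hx => simp only [map_smul]; exact hx.map (uniformContinuous_const_smul c)
  have hC : 0 ≤ C := (norm_nonneg _).trans (hT 0)
  have hη : η ∈ (Submodule.span ℂ s).topologicalClosure := hd ▸ Submodule.mem_top
  rw [Metric.cauchySeq_iff']
  intro ε hε
  obtain ⟨ζ, hζ, hζη⟩ := Metric.mem_closure_iff.mp hη (ε / (3 * (C + 1))) (by positivity)
  obtain ⟨N, hN⟩ := Metric.cauchySeq_iff'.mp (hspan ζ hζ) (ε / 3) (by positivity)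
  have hd : ∀ n, ‖T n (η - ζ)‖ ≤ ε / 3 := fun n => by
    rw [dist_eq_norm] at hζη
    calc ‖T n (η - ζ)‖ ≤ C * (ε / (3 * (C + 1))) :=
          ((T n).le_of_opNorm_le (hT n) _).trans (by gcongr)
      _ ≤ (C + 1) * (ε / (3 * (C + 1))) := by gcongr; linarith
      _ = ε / 3 := by field_simp
  refine ⟨N, fun n hn => ?_⟩
  have h1 := hN n hn
  rw [dist_eq_norm] at h1 ⊢
  have h2 : T n η - T N η = T n (η - ζ) + (T n ζ - T N ζ) - T N (η - ζ) := by
    rw [map_sub, map_sub]; abel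
  rw [h2]
  have := norm_sub_le (T n (η - ζ) + (T n ζ - T N ζ)) (T N (η - ζ))
  have := norm_add_le (T n (η - ζ)) (T n ζ - T N ζ)
  linarith [hd n, hd N]

namespace VonNeumannAlgebra

variable {H : Type*} [NormedAddCommGroup H] [InnerProductSpace ℂ H] [CompleteSpace H]
  {M : VonNeumannAlgebra H}

theorem mul_comm_of_mem_commutant {m y : H →L[ℂ] H} (hm : m ∈ M) (hy : y ∈ M.commutant) (η : H) :
    m (y η) = y (m η) :=
  congrArg (fun T => T η) (mem_commutant_iff.mp hy m hm)

/-- Pointwise limits of sequences in a von Neumann algebra belong to the algebra. -/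
theorem exists_elem_tendsto {x : ℕ → M.Elem}
    (hc : ∀ η : H, CauchySeq fun n => (x n : H →L[ℂ] H) η) :
    ∃ a : M.Elem, ∀ η : H, Tendsto (fun n => (x n : H →L[ℂ] H) η) atTop
      (𝓝 ((a : H →L[ℂ] H) η)) := by
  choose f hf using fun η => cauchySeq_tendsto_of_complete (hc η)
  let a : H →L[ℂ] H := continuousLinearMapOfTendsto (fun n => (x n : H →L[ℂ] H))
    (tendsto_pi_nhds.mpr hf)
  have ha : a ∈ M := by
    rw [← commutant_commutant M, mem_commutant_iff]
    intro y hy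
    ext η
    refine tendsto_nhds_unique (f := fun n => (x n : H →L[ℂ] H) (y η)) ?_ (hf (y η))
    simp only [mul_comm_of_mem_commutant (x _).2 hy]
    exact (y.continuous.tendsto _).comp (hf η)
  exact ⟨⟨a, ha⟩, hf⟩

namespace IsFaithfulNormalTrace

variable {τ : M.Elem →ₚ[ℂ] ℂ}

theorem exists_norm_toPreGNS_sq (hτ : M.IsFaithfulNormalTrace τ) :
    ∃ ξ : ℕ → H, (Summable fun n => ‖ξ n‖ ^ 2) ∧
      ∀ x : M.Elem, HasSum (fun n => ‖(x : H →L[ℂ] H) (ξ n)‖ ^ 2) (‖τ.toPreGNS x‖ ^ 2) := by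
  obtain ⟨ξ, hξ, h⟩ := hτ.normal
  refine ⟨ξ, hξ, fun x => ?_⟩
  have h1 := Complex.hasSum_re (h (star x * x))
  rw [← PositiveLinearMap.norm_toPreGNS_sq] at h1
  convert h1 using 2 with n
  change _ = (⟪ξ n, (star (x : H →L[ℂ] H)) ((x : H →L[ℂ] H) (ξ n))⟫_ℂ).re
  rw [ContinuousLinearMap.star_eq_adjoint, ContinuousLinearMap.adjoint_inner_right,
    inner_self_eq_norm_sq_to_K]
  norm_cast

/-- The closed span is invariant under the commutant, so its projection p lies in M. As 1 - p kills
every ξ_k, its 2-norm is 0, and faithfulness gives p = 1. -/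
theorem topologicalClosure_span_eq_top (hτ : M.IsFaithfulNormalTrace τ) {ξ : ℕ → H}
    (hξ : ∀ x : M.Elem, HasSum (fun n => ‖(x : H →L[ℂ] H) (ξ n)‖ ^ 2) (‖τ.toPreGNS x‖ ^ 2)) :
    (Submodule.span ℂ {η | ∃ y ∈ M.commutant, ∃ k, y (ξ k) = η}).topologicalClosure = ⊤ := by
  set K := (Submodule.span ℂ {η | ∃ y ∈ M.commutant, ∃ k, y (ξ k) = η}).topologicalClosure
    with hK
  have : CompleteSpace K :=
    (Submodule.isClosed_topologicalClosure _).completeSpace_coe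
  have hp : K.starProjection ∈ M := by
    rw [IsStarProjection.mem_iff isStarProjection_starProjection]
    intro y hy
    rw [Submodule.range_starProjection, Module.End.mem_invtSubmodule]
    have h1 : Submodule.span ℂ {η | ∃ y ∈ M.commutant, ∃ k, y (ξ k) = η} ≤
        K.comap (y : H →ₗ[ℂ] H) := by
      rw [Submodule.span_le]
      rintro _ ⟨z, hz, k, rfl⟩
      exact Submodule.le_topologicalClosure _
        (Submodule.subset_span ⟨y * z, mul_mem hy hz, k, rfl⟩)
    exact Submodule.topologicalClosure_minimal _ h1
      ((Submodule.isClosed_topologicalClosure _).preimage y.continuous)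
  have h2 : (1 : M.Elem) - ⟨K.starProjection, hp⟩ = 0 := by
    have h3 := hξ (1 - ⟨K.starProjection, hp⟩)
    have h4 : ∀ n, (((1 : M.Elem) - ⟨K.starProjection, hp⟩ : M.Elem) : H →L[ℂ] H) (ξ n) = 0 := by
      intro n
      change ξ n - K.starProjection (ξ n) = 0
      rw [sub_eq_zero, eq_comm, Submodule.starProjection_eq_self_iff]
      exact Submodule.le_topologicalClosure _
        (Submodule.subset_span ⟨1, one_mem _, n, rfl⟩)
    simp only [h4, norm_zero, zero_pow two_ne_zero] at h3
    have h5 := h3.unique hasSum_zero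
    apply hτ.faithful
    refine τ.eq_zero_of_re_eq_zero (star_mul_self_nonneg _) ?_
    rw [← PositiveLinearMap.norm_toPreGNS_sq, h5]
  rw [eq_top_iff]
  intro η _
  have h6 := congrArg (fun T : M.Elem => (T : H →L[ℂ] H) η) h2
  change η - K.starProjection η = 0 at h6
  exact Submodule.starProjection_eq_self_iff.mp (sub_eq_zero.mp h6).symm

theorem isCompleteTrace (hτ : M.IsFaithfulNormalTrace τ) : τ.IsCompleteTrace where
  map_mul_comm := hτ.map_mul_comm
  faithful := hτ.faithful
  complete x hx hc := by
    obtain ⟨ξ, hξs, hξ⟩ := hτ.exists_norm_toPreGNS_sq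
    have hle : ∀ (a : M.Elem) k, ‖(a : H →L[ℂ] H) (ξ k)‖ ≤ ‖τ.toPreGNS a‖ := fun a k =>
      le_of_sq_le_sq (le_hasSum (hξ a) k fun _ _ => by positivity) (norm_nonneg _)
    have hx1 : ∀ n, ‖(x n : H →L[ℂ] H)‖ ≤ 1 := fun n =>
      (CStarAlgebra.norm_le_one_iff_of_nonneg (x n) (hx n).1).mpr (hx n).2
    have hcξ : ∀ k, CauchySeq fun n => (x n : H →L[ℂ] H) (ξ k) := fun k => by
      rw [Metric.cauchySeq_iff'] at hc ⊢
      intro ε hε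
      obtain ⟨N, hN⟩ := hc ε hε
      refine ⟨N, fun n hn => lt_of_le_of_lt ?_ (hN n hn)⟩
      rw [dist_eq_norm, dist_eq_norm, ← map_sub]
      exact hle (x n - x N) k
    -- The 2-norm controls each x_n ξ_k, hence also x_n y ξ_k = y x_n ξ_k for y in the commutant.
    -- These vectors are total and the sequence is bounded, so it converges strongly.
    obtain ⟨a, ha⟩ := exists_elem_tendsto (x := x) <|
      ContinuousLinearMap.cauchySeq_apply_of_dense hx1 (by
        rintro _ ⟨y, hy, k, rfl⟩
        simp only [mul_comm_of_mem_commutant (x _).2 hy]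
        exact (hcξ k).map y.uniformContinuous) (hτ.topologicalClosure_span_eq_top hξ)
    refine ⟨a, ?_⟩
    have ha1 : ‖(a : H →L[ℂ] H)‖ ≤ 1 := ContinuousLinearMap.opNorm_le_bound _ zero_le_one fun η =>
      le_of_tendsto' (ha η).norm fun n => (x n : H →L[ℂ] H).le_of_opNorm_le (hx1 n) η
    rw [tendsto_iff_norm_sub_tendsto_zero]
    have h1 : Tendsto (fun n => ∑' k, ‖((x n - a : M.Elem) : H →L[ℂ] H) (ξ k)‖ ^ 2) atTop
        (𝓝 (∑' _ : ℕ, (0 : ℝ))) := by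
      -- Strong convergence is upgraded to 2-norm convergence; the bound uses ‖x_n - a‖ ≤ 2 and ∑
      -- ‖ξ_k‖² < ∞.
      refine tendsto_tsum_of_dominated_convergence (bound := fun k => (2 * ‖ξ k‖) ^ 2) ?_ ?_ ?_
      · simpa only [mul_pow] using hξs.mul_left _
      · intro k
        have := ((ha (ξ k)).sub_const ((a : H →L[ℂ] H) (ξ k))).norm.pow 2
        rw [sub_self, norm_zero, zero_pow two_ne_zero] at this
        exact this
      · refine .of_forall fun n k => ?_
        rw [Real.norm_of_nonneg (by positivity)]
        gcongr
        refine ContinuousLinearMap.le_of_opNorm_le _ ?_ _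
        refine (norm_sub_le (x n : H →L[ℂ] H) a).trans ?_
        linarith [hx1 n]
    simp only [(hξ _).tsum_eq, tsum_zero] at h1
    have h2 := h1.sqrt
    simp only [Real.sqrt_zero, Real.sqrt_sq (norm_nonneg _)] at h2
    simpa only [map_sub] using h2

end IsFaithfulNormalTrace

end VonNeumannAlgebra

/-- A ⋆-isomorphism transports complete traces. -/
theorem PositiveLinearMap.IsCompleteTrace.exists_comp {A B : Type*}
    [CStarAlgebra A] [PartialOrder A] [StarOrderedRing A]
    [CStarAlgebra B] [PartialOrder B] [StarOrderedRing B] {τ : B →ₚ[ℂ] ℂ}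
    (hτ : τ.IsCompleteTrace) (Φ : A ≃⋆ₐ[ℂ] B) :
    ∃ φ : A →ₚ[ℂ] ℂ, φ.IsCompleteTrace ∧ ∀ a, φ a = τ (Φ a) := by
  let φ : A →ₚ[ℂ] ℂ := τ.comp (PositiveLinearMap.ofClass Φ)
  have hφ : ∀ a, φ a = τ (Φ a) := fun a => rfl
  have hn : ∀ a, ‖φ.toPreGNS a‖ = ‖τ.toPreGNS (Φ a)‖ := fun a => by
    rw [← sq_eq_sq₀ (norm_nonneg _) (norm_nonneg _), norm_toPreGNS_sq, norm_toPreGNS_sq, hφ,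
      map_mul, map_star]
  refine ⟨φ, ⟨fun x y => ?_, fun x hx => ?_, fun x hx hc => ?_⟩, hφ⟩
  · rw [hφ, hφ, map_mul Φ, map_mul Φ, hτ.map_mul_comm]
  · rw [hφ, map_mul Φ, map_star Φ] at hx
    exact (map_eq_zero_iff Φ Φ.injective).mp (hτ.faithful _ hx)
  · obtain ⟨b, hb⟩ := hτ.complete (fun n => Φ (x n))
      (fun n => ⟨map_nonneg Φ (hx n).1, map_one Φ ▸ OrderHomClass.mono Φ (hx n).2⟩) (by
        rw [Metric.cauchySeq_iff'] at hc ⊢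
        simpa only [dist_eq_norm, ← map_sub, hn] using hc)
    refine ⟨Φ.symm b, ?_⟩
    rw [tendsto_iff_norm_sub_tendsto_zero] at hb ⊢
    simpa only [← map_sub, hn, map_sub Φ, StarAlgEquiv.apply_symm_apply] using hb

/-- The pulled-back trace is not known to be normal, but it is complete, so uniqueness applies. This
provides the unitaries on L² that implement Φ and the automorphisms α_g. -/
theorem VonNeumannAlgebra.IsFaithfulNormalTrace.apply_starAlgEquiv
    {H₁ : Type*} [NormedAddCommGroup H₁] [InnerProductSpace ℂ H₁] [CompleteSpace H₁]
    {H₂ : Type*} [NormedAddCommGroup H₂] [InnerProductSpace ℂ H₂] [CompleteSpace H₂]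
    {M₁ : VonNeumannAlgebra H₁} {M₂ : VonNeumannAlgebra H₂}
    (hZ : ∀ z : M₁.Elem, (∀ x : M₁.Elem, z * x = x * z) → ∃ c : ℂ, z = c • 1)
    {τ₁ : M₁.Elem →ₚ[ℂ] ℂ} (hτ₁ : M₁.IsFaithfulNormalTrace τ₁)
    {τ₂ : M₂.Elem →ₚ[ℂ] ℂ} (hτ₂ : M₂.IsFaithfulNormalTrace τ₂)
    (Φ : M₁.Elem ≃⋆ₐ[ℂ] M₂.Elem) (x : M₁.Elem) : τ₂ (Φ x) = τ₁ x := by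
  obtain ⟨φ, hφ, h⟩ := hτ₂.isCompleteTrace.exists_comp Φ
  rw [← h, hτ₁.isCompleteTrace.eq_of_center_trivial hφ hZ
    (by rw [h, _root_.map_one Φ, hτ₁.map_one, hτ₂.map_one]) (by rw [hτ₁.map_one]; exact one_ne_zero)]

/-! ### Isometries and weighted shifts on `ℓ²`-spaces -/

section lp

variable {G₁ G₂ K₁ K₂ : Type*} [NormedAddCommGroup K₁] [InnerProductSpace ℂ K₁]
  [NormedAddCommGroup K₂] [InnerProductSpace ℂ K₂]

omit [InnerProductSpace ℂ K₁] in
theorem lp.hasSum_norm_sq (f : lp (fun _ : G₁ => K₁) 2) :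
    HasSum (fun h => ‖f h‖ ^ 2) (‖f‖ ^ 2) := by
  have := lp.hasSum_norm (p := 2) (by simp) f
  simpa only [ENNReal.toReal_ofNat, Real.rpow_ofNat] using this

theorem memℓp_isometry_comp (σ : G₂ ≃ G₁) (U : G₂ → (K₁ ≃ₗᵢ[ℂ] K₂))
    (f : lp (fun _ : G₁ => K₁) 2) : Memℓp (fun h => U h (f (σ h))) 2 := by
  apply memℓp_gen
  simp only [ENNReal.toReal_ofNat, Real.rpow_ofNat, LinearIsometryEquiv.norm_map]
  exact (σ.hasSum_iff.mpr (lp.hasSum_norm_sq f)).summable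

/-- The isometric isomorphism `(W f)(h) = U_h (f (σ⁻¹ h))` of `ℓ²`-spaces. -/
def lpIsometryEquiv (σ : G₁ ≃ G₂) (U : G₂ → (K₁ ≃ₗᵢ[ℂ] K₂)) :
    lp (fun _ : G₁ => K₁) 2 ≃ₗᵢ[ℂ] lp (fun _ : G₂ => K₂) 2 where
  toFun f := ⟨fun h => U h (f (σ.symm h)), memℓp_isometry_comp σ.symm U f⟩
  invFun f := ⟨fun g => (U (σ g)).symm (f (σ g)),
    memℓp_isometry_comp σ (fun g => (U (σ g)).symm) f⟩
  map_add' f f' := by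
    ext h
    exact map_add (U h) _ _
  map_smul' c f := by
    ext h
    exact map_smul (U h) c _
  left_inv f := by
    ext g
    change (U (σ g)).symm (U (σ g) (f (σ.symm (σ g)))) = f g
    rw [LinearIsometryEquiv.symm_apply_apply, Equiv.symm_apply_apply]
  right_inv f := by
    ext h
    change U h ((U (σ (σ.symm h))).symm (f (σ (σ.symm h)))) = f h
    rw [Equiv.apply_symm_apply, LinearIsometryEquiv.apply_symm_apply]
  norm_map' f := by
    rw [← sq_eq_sq₀ (norm_nonneg _) (norm_nonneg _)]
    refine (lp.hasSum_norm_sq _).unique ?_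
    have := σ.symm.hasSum_iff.mpr (lp.hasSum_norm_sq f)
    convert this using 2 with h
    exact congrArg (· ^ 2) ((U h).norm_map _)

theorem weightedShift_apply {σ : Equiv.Perm G₁} {T : G₁ → K₁ →L[ℂ] K₁} {C : ℝ}
    (hC : ∀ h, ‖T h‖ ≤ C) (f : lp (fun _ : G₁ => K₁) 2) (h : G₁) :
    weightedShift σ T C hC f h = T h (f (σ h)) := rfl

theorem star_weightedShift_refl [CompleteSpace K₁] {T : G₁ → K₁ →L[ℂ] K₁} {C C' : ℝ}
    (hC : ∀ h, ‖T h‖ ≤ C) (hC' : ∀ h, ‖star (T h)‖ ≤ C') :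
    star (weightedShift (Equiv.refl G₁) T C hC) =
      weightedShift (Equiv.refl G₁) (fun h => star (T h)) C' hC' := by
  rw [ContinuousLinearMap.star_eq_adjoint]
  symm
  rw [ContinuousLinearMap.eq_adjoint_iff]
  intro f f'
  rw [lp.inner_eq_tsum, lp.inner_eq_tsum]
  refine tsum_congr fun h => ?_
  rw [weightedShift_apply, weightedShift_apply, ContinuousLinearMap.star_eq_adjoint,
    ContinuousLinearMap.adjoint_inner_left]
  rfl

end lp

/-! ### Generated von Neumann algebras -/

namespace VonNeumannAlgebra

variable {H : Type*} [NormedAddCommGroup H] [InnerProductSpace ℂ H] [CompleteSpace H]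
  {H' : Type*} [NormedAddCommGroup H'] [InnerProductSpace ℂ H'] [CompleteSpace H']

theorem mem_generatedBy_iff {S : Set (H →L[ℂ] H)} {T : H →L[ℂ] H} :
    T ∈ (generatedBy S).toStarSubalgebra ↔
      ∀ y, (∀ s ∈ S, Commute s y) → (∀ s ∈ S, Commute s (star y)) → Commute T y := by
  have h0 : T ∈ (generatedBy S).toStarSubalgebra ↔
      T ∈ Set.centralizer (Set.centralizer (S ∪ star S)) := by
    rw [← StarSubalgebra.coe_centralizer_centralizer ℂ]
    rfl
  have h1 : ∀ y, y ∈ Set.centralizer (S ∪ star S) ↔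
      (∀ s ∈ S, Commute s y) ∧ (∀ s ∈ S, Commute s (star y)) := fun y => by
    rw [Set.centralizer_union, Set.mem_inter_iff]
    refine and_congr Iff.rfl ⟨fun h s hs => ?_, fun h s hs => ?_⟩
    · have : Commute (star s) y := h (star s) (by simpa using hs)
      simpa using this.star_star
    · have := (h (star s) hs).star_star
      rwa [star_star, star_star] at this
  rw [h0]
  exact ⟨fun h y hy hy' => (h y ((h1 y).mpr ⟨hy, hy'⟩)).symm,
    fun h y hy => (h y ((h1 y).mp hy).1 ((h1 y).mp hy).2).symm⟩

theorem commute_of_mem_generatedBy {S : Set (H →L[ℂ] H)} {T y : H →L[ℂ] H}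
    (hT : T ∈ (generatedBy S).toStarSubalgebra) (h : ∀ s ∈ S, Commute s y)
    (h' : ∀ s ∈ S, Commute s (star y)) : Commute T y :=
  mem_generatedBy_iff.mp hT y h h'

/-- An isometric isomorphism that commutes with the generators commutes with the generated
von Neumann algebra. -/
theorem apply_comm_of_mem_generatedBy {S : Set (H →L[ℂ] H)} {T : H →L[ℂ] H}
    (hT : T ∈ (generatedBy S).toStarSubalgebra) (V : H ≃ₗᵢ[ℂ] H)
    (h : ∀ s ∈ S, ∀ f, s (V f) = V (s f)) (f : H) : T (V f) = V (T f) := by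
  let y : H →L[ℂ] H := (V : H →L[ℂ] H)
  have hy : star y = (V.symm : H →L[ℂ] H) := by
    rw [ContinuousLinearMap.star_eq_adjoint]
    exact V.adjoint_eq_symm
  refine congrArg (fun A => A f) (commute_of_mem_generatedBy (y := y) hT
    (fun s hs => ContinuousLinearMap.ext (h s hs)) fun s hs => ?_).eq
  rw [hy]
  refine ContinuousLinearMap.ext fun f => ?_
  change s (V.symm f) = V.symm (s f)
  rw [LinearIsometryEquiv.eq_symm_apply, ← h s hs, LinearIsometryEquiv.apply_symm_apply]

/-- Conjugation by W⁻¹ carries the commutant of S' ∪ S'⋆ into that of S ∪ S⋆, so checking generators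
suffices and no topology is needed. -/
theorem conj_mem_generatedBy {S : Set (H →L[ℂ] H)} {S' : Set (H' →L[ℂ] H')} (W : H ≃ₗᵢ[ℂ] H')
    (h : ∀ s ∈ S, W.conjStarAlgEquiv s ∈ (generatedBy S').toStarSubalgebra) {T : H →L[ℂ] H}
    (hT : T ∈ (generatedBy S).toStarSubalgebra) :
    W.conjStarAlgEquiv T ∈ (generatedBy S').toStarSubalgebra := by
  rw [mem_generatedBy_iff]
  intro y hy hy'
  have key : ∀ z, (∀ s ∈ S', Commute s z) → (∀ s ∈ S', Commute s (star z)) → ∀ s ∈ S,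
      Commute s (W.conjStarAlgEquiv.symm z) := fun z hz hz' s hs => by
    have := (commute_of_mem_generatedBy (h s hs) hz hz').map W.conjStarAlgEquiv.symm
    rwa [StarAlgEquiv.symm_apply_apply] at this
  have := (commute_of_mem_generatedBy hT (key y hy hy') (by
    intro s hs
    rw [← map_star]
    exact key (star y) hy' (by rwa [star_star]) s hs)).map W.conjStarAlgEquiv
  rwa [StarAlgEquiv.apply_symm_apply] at this

/-- A spatial isomorphism of generated von Neumann algebras. -/
def conjEquiv {S : Set (H →L[ℂ] H)} {S' : Set (H' →L[ℂ] H')} (W : H ≃ₗᵢ[ℂ] H')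
    (h : ∀ s ∈ S, W.conjStarAlgEquiv s ∈ (generatedBy S').toStarSubalgebra)
    (h' : ∀ s ∈ S', W.conjStarAlgEquiv.symm s ∈ (generatedBy S).toStarSubalgebra) :
    (generatedBy S).Elem ≃⋆ₐ[ℂ] (generatedBy S').Elem where
  toFun T := ⟨W.conjStarAlgEquiv T, conj_mem_generatedBy W h T.2⟩
  invFun T := ⟨W.conjStarAlgEquiv.symm T, by
    rw [LinearIsometryEquiv.symm_conjStarAlgEquiv]
    exact conj_mem_generatedBy W.symm
      (by rwa [← LinearIsometryEquiv.symm_conjStarAlgEquiv]) T.2⟩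
  left_inv T := Subtype.ext (StarAlgEquiv.symm_apply_apply _ _)
  right_inv T := Subtype.ext (StarAlgEquiv.apply_symm_apply _ _)
  map_mul' _ _ := Subtype.ext (map_mul W.conjStarAlgEquiv _ _)
  map_add' _ _ := Subtype.ext (map_add W.conjStarAlgEquiv _ _)
  map_star' _ := Subtype.ext (map_star W.conjStarAlgEquiv _)
  map_smul' c _ := Subtype.ext (map_smul W.conjStarAlgEquiv c _)

end VonNeumannAlgebra

/-! ### Isometries between GNS spaces -/

namespace PositiveLinearMap

variable {A B : Type*} [CStarAlgebra A] [PartialOrder A] [StarOrderedRing A]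
    [CStarAlgebra B] [PartialOrder B] [StarOrderedRing B]

/-- The map of GNS spaces induced by a trace-preserving ⋆-isomorphism. -/
def gnsMap {τ : A →ₚ[ℂ] ℂ} {φ : B →ₚ[ℂ] ℂ} (Φ : A ≃⋆ₐ[ℂ] B) (h : ∀ a, φ (Φ a) = τ a) :
    τ.GNS →L[ℂ] φ.GNS :=
  (LinearMap.mkContinuous (φ.toPreGNS.toLinearMap ∘ₗ
    (Φ : A →ₐ[ℂ] B).toLinearMap ∘ₗ τ.ofPreGNS.toLinearMap) 1 fun x => by
      obtain ⟨x, rfl⟩ := τ.toPreGNS.surjective x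
      rw [one_mul]
      refine le_of_sq_le_sq ?_ (norm_nonneg _)
      change ‖φ.toPreGNS (Φ x)‖ ^ 2 ≤ _
      rw [norm_toPreGNS_sq, norm_toPreGNS_sq, ← map_star, ← map_mul, h]).completion

theorem gnsMap_coe {τ : A →ₚ[ℂ] ℂ} {φ : B →ₚ[ℂ] ℂ} (Φ : A ≃⋆ₐ[ℂ] B) (h : ∀ a, φ (Φ a) = τ a)
    (a : A) : gnsMap Φ h (τ.toPreGNS a) = φ.toPreGNS (Φ a) := by
  rw [gnsMap, ContinuousLinearMap.completion_apply_coe]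
  rfl

/-- The isometric isomorphism of GNS spaces that implements a trace-preserving ⋆-isomorphism. -/
def gnsEquiv {τ : A →ₚ[ℂ] ℂ} {φ : B →ₚ[ℂ] ℂ} (Φ : A ≃⋆ₐ[ℂ] B) (h : ∀ a, φ (Φ a) = τ a) :
    τ.GNS ≃ₗᵢ[ℂ] φ.GNS where
  toLinearEquiv := LinearEquiv.ofLinearMap (gnsMap Φ h).toLinearMap
    (gnsMap Φ.symm fun b => by rw [← h, StarAlgEquiv.apply_symm_apply]).toLinearMap
    (congrArg ContinuousLinearMap.toLinearMap <| gns_ext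
      (S := gnsMap Φ h ∘L gnsMap Φ.symm fun b => by rw [← h, StarAlgEquiv.apply_symm_apply])
      (T := ContinuousLinearMap.id ℂ _) fun b => by
        rw [ContinuousLinearMap.comp_apply, gnsMap_coe, gnsMap_coe, StarAlgEquiv.apply_symm_apply,
          ContinuousLinearMap.id_apply])
    (congrArg ContinuousLinearMap.toLinearMap <| gns_ext
      (S := (gnsMap Φ.symm fun b => by rw [← h, StarAlgEquiv.apply_symm_apply]) ∘L gnsMap Φ h)
      (T := ContinuousLinearMap.id ℂ _) fun b => by
        rw [ContinuousLinearMap.comp_apply, gnsMap_coe, gnsMap_coe, StarAlgEquiv.symm_apply_apply,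
          ContinuousLinearMap.id_apply])
  norm_map' ξ := by
    change ‖gnsMap Φ h ξ‖ = ‖ξ‖
    induction ξ using UniformSpace.Completion.induction_on with
    | hp => exact isClosed_eq (gnsMap Φ h).continuous.norm continuous_norm
    | ih a =>
      obtain ⟨a, rfl⟩ := τ.toPreGNS.surjective a
      rw [gnsMap_coe, UniformSpace.Completion.norm_coe, UniformSpace.Completion.norm_coe,
        ← sq_eq_sq₀ (norm_nonneg _) (norm_nonneg _), norm_toPreGNS_sq, norm_toPreGNS_sq,
        ← map_star, ← map_mul, h]

theorem gnsEquiv_gnsStarAlgHom {τ : A →ₚ[ℂ] ℂ} {φ : B →ₚ[ℂ] ℂ} (Φ : A ≃⋆ₐ[ℂ] B)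
    (h : ∀ a, φ (Φ a) = τ a) (a : A) (ξ : τ.GNS) :
    gnsEquiv Φ h (τ.gnsStarAlgHom a ξ) = φ.gnsStarAlgHom (Φ a) (gnsEquiv Φ h ξ) := by
  have : gnsMap Φ h ∘L τ.gnsStarAlgHom a = φ.gnsStarAlgHom (Φ a) ∘L gnsMap Φ h :=
    gns_ext fun b => by
      simp only [ContinuousLinearMap.comp_apply, gnsMap_coe, gnsStarAlgHom_coe, map_mul]
  exact congrArg (fun T => T ξ) this

end PositiveLinearMap

/-- The image of a unitary under a ⋆-isomorphism. -/
def StarAlgEquiv.mapUnitary {A B : Type*} [Ring A] [StarRing A] [Algebra ℂ A] [Ring B] [StarRing B]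
    [Algebra ℂ B] (Φ : A ≃⋆ₐ[ℂ] B) (u : unitary A) : unitary B :=
  ⟨Φ u, Unitary.map_mem Φ u.2⟩

/-! ### Cocycle identities -/

namespace CocycleAction

section algebra

variable {G : Type*} [Group G] {A : Type*} [Ring A] [StarRing A] [Algebra ℂ A]
  (α : CocycleAction G A)

theorem coc_mul_star (g h : G) : (α.coc g h : A) * star (α.coc g h : A) = 1 :=
  Unitary.mul_star_self_of_mem (α.coc g h).2

theorem star_coc_mul (g h : G) : star (α.coc g h : A) * α.coc g h = 1 :=
  Unitary.star_mul_self_of_mem (α.coc g h).2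

theorem aut_one_symm (x : A) : (α.aut 1).symm x = x := by
  rw [← α.aut_one ((α.aut 1).symm x), StarAlgEquiv.apply_symm_apply]

theorem aut_mul_apply (g h : G) (x : A) :
    α.aut (g * h) x = star (α.coc g h : A) * α.aut g (α.aut h x) * α.coc g h := by
  rw [α.aut_mul, mul_assoc, mul_assoc, star_coc_mul, mul_one, ← mul_assoc, star_coc_mul, one_mul]

theorem aut_symm_eq (g l : G) (z : A) :
    (α.aut l).symm z =
      (α.aut (g * l)).symm (star (α.coc g l : A) * α.aut g z * α.coc g l) := by
  refine EquivLike.injective (α.aut (g * l)) ?_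
  rw [eq_comm, StarAlgEquiv.apply_symm_apply,
    α.aut_mul_apply, StarAlgEquiv.apply_symm_apply]

theorem aut_symm_mul (g h : G) (x : A) :
    α.aut h ((α.aut (g * h)).symm x) =
      (α.aut g).symm (α.coc g h * x * star (α.coc g h : A)) := by
  refine EquivLike.injective (α.aut g) ?_
  rw [eq_comm, StarAlgEquiv.apply_symm_apply, α.aut_mul,
    StarAlgEquiv.apply_symm_apply]

/-- The coefficient at g l of the covariance relation u_g x = α_g(x) u_g. -/
theorem coc_mul_aut_symm (g l : G) (x : A) :
    (α.aut (g * l)).symm (α.coc g l) * (α.aut l).symm x =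
      (α.aut (g * l)).symm (α.aut g x * α.coc g l) := by
  rw [α.aut_symm_eq g l, ← map_mul, ← mul_assoc, ← mul_assoc, coc_mul_star, one_mul]

theorem star_aut_coc_mul (g l k : G) :
    star (α.aut g (α.coc l k)) * α.coc g l =
      α.coc g (l * k) * star (α.coc (g * l) k : A) := by
  have h1 : star (α.aut g (α.coc l k)) * α.aut g (α.coc l k) = 1 := by
    rw [← map_star, ← map_mul, star_coc_mul, map_one]
  have h2 := congrArg (fun x => star (α.aut g (α.coc l k)) * x * star (α.coc (g * l) k : A))
    (α.coc_assoc g l k)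
  simp only [← mul_assoc, h1, one_mul] at h2
  rw [← h2, mul_assoc, coc_mul_star, mul_one]

/-- The coefficient form of the fact that u_g commutes with right translation by k; it is the
2-cocycle identity. The next identity is its analogue for the copy of the algebra. -/
theorem coc_mul_aut_symm_star_coc (g l k : G) :
    (α.aut (g * l)).symm (α.coc g l) * (α.aut l).symm (star (α.coc l k : A)) =
      (α.aut (g * l)).symm (star (α.coc (g * l) k : A)) *
        α.aut k ((α.aut (g * l * k)).symm (α.coc g (l * k))) := by
  rw [coc_mul_aut_symm, α.aut_symm_mul (g * l) k, ← map_mul, map_star, star_aut_coc_mul,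
    ← mul_assoc, ← mul_assoc, star_coc_mul, one_mul]

theorem aut_symm_mul_star_coc (h k : G) (x : A) :
    (α.aut h).symm x * (α.aut h).symm (star (α.coc h k : A)) =
      (α.aut h).symm (star (α.coc h k : A)) * α.aut k ((α.aut (h * k)).symm x) := by
  rw [α.aut_symm_mul, ← map_mul, ← map_mul, ← mul_assoc, ← mul_assoc, star_coc_mul, one_mul]

end algebra

end CocycleAction

namespace CocycleAction

section relations

variable {A : Type*} [CStarAlgebra A] {K : Type*} [NormedAddCommGroup K] [InnerProductSpace ℂ K]
  [CompleteSpace K] {G : Type*} [Group G] (α : CocycleAction G A) (π : A →⋆ₐ[ℂ] (K →L[ℂ] K))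

/-! ### Crossed products in a general representation -/

/-- The copy of `A` on `ℓ²(G, K)`, for a representation `π` of `A` on `K`. -/
def repOp (x : A) : lp (fun _ : G => K) 2 →L[ℂ] lp (fun _ : G => K) 2 :=
  weightedShift (Equiv.refl G) (fun h => π ((α.aut h).symm x)) ‖x‖ fun h =>
    (NonUnitalStarAlgHom.norm_apply_le π _).trans
      (NonUnitalStarAlgHom.norm_apply_le (α.aut h).symm x)

/-- The unitaries `u_g` on `ℓ²(G, K)`, for a representation `π` of `A` on `K`. -/
def shiftOp (g : G) : lp (fun _ : G => K) 2 →L[ℂ] lp (fun _ : G => K) 2 :=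
  weightedShift (Equiv.mulLeft g⁻¹)
    (fun h => π ((α.aut h).symm (α.coc g (g⁻¹ * h)))) 1 fun h =>
    (NonUnitalStarAlgHom.norm_apply_le π _).trans
      ((NonUnitalStarAlgHom.norm_apply_le (α.aut h).symm _).trans
        (norm_unitary_le_one _))

/-- The von Neumann algebra generated by the copy of `A` and the unitaries `u_g`. -/
def repCrossedProduct : VonNeumannAlgebra (lp (fun _ : G => K) 2) :=
  VonNeumannAlgebra.generatedBy (Set.range (α.repOp π) ∪ Set.range (α.shiftOp π))

theorem repOp_apply (x : A) (f : lp (fun _ : G => K) 2) (h : G) :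
    α.repOp π x f h = π ((α.aut h).symm x) (f h) := rfl

theorem shiftOp_apply (g : G) (f : lp (fun _ : G => K) 2) (h : G) :
    α.shiftOp π g f h = π ((α.aut h).symm (α.coc g (g⁻¹ * h))) (f (g⁻¹ * h)) := rfl

theorem shiftOp_apply_mul (g : G) (f : lp (fun _ : G => K) 2) (l : G) :
    α.shiftOp π g f (g * l) = π ((α.aut (g * l)).symm (α.coc g l)) (f l) := by
  rw [shiftOp_apply, inv_mul_cancel_left]

omit [CompleteSpace K] [Group G] in
theorem clm_ext {S T : lp (fun _ : G => K) 2 →L[ℂ] lp (fun _ : G => K) 2}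
    (h : ∀ f k, S f k = T f k) : S = T :=
  ContinuousLinearMap.ext fun f => lp.ext (funext (h f))

theorem star_repOp (x : A) : star (α.repOp π x) = α.repOp π (star x) := by
  have h1 : ∀ h, ‖star (π ((α.aut h).symm x))‖ ≤ ‖x‖ := fun h => by
    rw [norm_star]
    exact (NonUnitalStarAlgHom.norm_apply_le π _).trans
      (NonUnitalStarAlgHom.norm_apply_le (α.aut h).symm x)
  refine (star_weightedShift_refl _ h1).trans (clm_ext fun f k => ?_)
  rw [weightedShift_apply, repOp_apply, map_star, map_star]
  rfl

/-- The canonical embedding of `A` into the crossed product. -/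
def repHom : A →⋆ₐ[ℂ] (α.repCrossedProduct π).Elem where
  toFun x := ⟨α.repOp π x, VonNeumannAlgebra.subset_generatedBy _ (Or.inl ⟨x, rfl⟩)⟩
  map_one' := Subtype.ext <| clm_ext fun f k => by
    change α.repOp π 1 f k = f k
    rw [repOp_apply, map_one, map_one, one_apply_eq_self]
  map_mul' x y := Subtype.ext <| clm_ext fun f k => by
    change α.repOp π (x * y) f k = α.repOp π x (α.repOp π y f) k
    rw [repOp_apply, repOp_apply, repOp_apply, map_mul, map_mul, mul_apply_eq_comp]
  map_zero' := Subtype.ext <| clm_ext fun f k => by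
    change α.repOp π 0 f k = 0
    rw [repOp_apply, map_zero, map_zero, _root_.zero_apply]
  map_add' x y := Subtype.ext <| clm_ext fun f k => by
    change α.repOp π (x + y) f k = α.repOp π x f k + α.repOp π y f k
    rw [repOp_apply, repOp_apply, repOp_apply, map_add, map_add, _root_.add_apply]
  commutes' c := Subtype.ext <| clm_ext fun f k => by
    change α.repOp π (algebraMap ℂ _ c) f k = c • f k
    rw [repOp_apply, Algebra.algebraMap_eq_smul_one, map_smul, map_smul, map_one, map_one]
    rfl
  map_star' x := Subtype.ext (α.star_repOp π x).symm

/-- The canonical unitaries of the crossed product. -/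
def groupElem (g : G) : (α.repCrossedProduct π).Elem :=
  ⟨α.shiftOp π g, VonNeumannAlgebra.subset_generatedBy _ (Or.inr ⟨g, rfl⟩)⟩

theorem groupElem_one : α.groupElem π 1 = 1 := Subtype.ext <| clm_ext fun f k => by
  change α.shiftOp π 1 f k = f k
  rw [shiftOp_apply, α.coc_one_left, OneMemClass.coe_one, map_one, map_one, one_apply_eq_self,
    inv_one, one_mul]

theorem groupElem_mul_repHom (g : G) (x : A) :
    α.groupElem π g * α.repHom π x = α.repHom π (α.aut g x) * α.groupElem π g :=
  Subtype.ext <| clm_ext fun f k => by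
    obtain ⟨l, rfl⟩ : ∃ l, k = g * l := ⟨g⁻¹ * k, by group⟩
    change α.shiftOp π g (α.repOp π x f) (g * l) =
      α.repOp π (α.aut g x) (α.shiftOp π g f) (g * l)
    rw [shiftOp_apply_mul, repOp_apply, repOp_apply, shiftOp_apply_mul, ← mul_apply_eq_comp,
      ← mul_apply_eq_comp, ← map_mul, ← map_mul, coc_mul_aut_symm, ← map_mul]

theorem groupElem_mul_groupElem (g h : G) :
    α.groupElem π g * α.groupElem π h = α.repHom π (α.coc g h) * α.groupElem π (g * h) :=
  Subtype.ext <| clm_ext fun f k => by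
    obtain ⟨l, rfl⟩ : ∃ l, k = g * (h * l) := ⟨h⁻¹ * (g⁻¹ * k), by group⟩
    change α.shiftOp π g (α.shiftOp π h f) (g * (h * l)) =
      α.repOp π (α.coc g h) (α.shiftOp π (g * h) f) (g * (h * l))
    rw [shiftOp_apply_mul, shiftOp_apply_mul, repOp_apply, ← mul_assoc, shiftOp_apply_mul,
      ← mul_apply_eq_comp, ← mul_apply_eq_comp, ← map_mul, ← map_mul, ← map_mul, mul_assoc g h l,
      coc_mul_aut_symm, α.coc_assoc]

theorem norm_shiftOp_apply (g : G) (f : lp (fun _ : G => K) 2) : ‖α.shiftOp π g f‖ = ‖f‖ := by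
  rw [← sq_eq_sq₀ (norm_nonneg _) (norm_nonneg _)]
  refine (lp.hasSum_norm_sq _).unique ?_
  have := (Equiv.mulLeft g⁻¹).hasSum_iff.mpr (lp.hasSum_norm_sq f)
  convert this using 2 with h
  rw [shiftOp_apply, ContinuousLinearMap.norm_map_of_mem_unitary]
  · rfl
  · exact Unitary.map_mem π (Unitary.map_mem (α.aut h).symm (α.coc g (g⁻¹ * h)).2)

theorem star_groupElem_mul (g : G) : star (α.groupElem π g) * α.groupElem π g = 1 :=
  Subtype.ext <| (ContinuousLinearMap.norm_map_iff_adjoint_comp_self (α.shiftOp π g)).mp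
    (α.norm_shiftOp_apply π g)

theorem groupElem_mul_star (g : G) : α.groupElem π g * star (α.groupElem π g) = 1 := by
  -- An isometry with a right inverse is unitary; the right inverse comes from u_g u_{g⁻¹} =
  -- v_{g,g⁻¹}. This avoids computing the adjoint of u_g.
  obtain ⟨r, h1⟩ : ∃ r, α.groupElem π g * r = 1 := by
    refine ⟨α.groupElem π g⁻¹ * α.repHom π (star (α.coc g g⁻¹ : A)), ?_⟩
    rw [← mul_assoc, groupElem_mul_groupElem, mul_inv_cancel, groupElem_one, mul_one,
      ← map_mul, coc_mul_star, map_one]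
  calc _ = α.groupElem π g * star (α.groupElem π g) * (α.groupElem π g * r) := by
        rw [h1, mul_one]
    _ = α.groupElem π g * (star (α.groupElem π g) * α.groupElem π g) * r := by
        simp only [mul_assoc]
    _ = 1 := by rw [star_groupElem_mul, mul_one, h1]

end relations

end CocycleAction

/-! ### The commutant of the crossed product -/

/-- A representation of a C⋆-algebra `A` on a Hilbert space together with operators of right
multiplication on a unit vector, such that the commutant of the latter is the image of `A`. -/
structure StandardRep (A : Type*) [CStarAlgebra A] (K : Type*) [NormedAddCommGroup K]
    [InnerProductSpace ℂ K] [CompleteSpace K] where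
  /-- left multiplication -/
  rep : A →⋆ₐ[ℂ] (K →L[ℂ] K)
  /-- right multiplication -/
  right : A → K →L[ℂ] K
  /-- the trace vector -/
  vac : K
  rep_injective : Function.Injective rep
  commute : ∀ a b, Commute (rep a) (right b)
  exists_rep_eq : ∀ T : K →L[ℂ] K, (∀ b, Commute T (right b)) → ∃ a, rep a = T
  norm_vac : ‖vac‖ = 1
  dense_right : DenseRange fun b => right b vac

namespace CocycleAction

variable {A : Type*} [CStarAlgebra A] {K : Type*} [NormedAddCommGroup K] [InnerProductSpace ℂ K]
  [CompleteSpace K] {G : Type*} [Group G] {α : CocycleAction G A} {π : A →⋆ₐ[ℂ] (K →L[ℂ] K)}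

/-- The diagonal operator with constant entry. -/
def constDiag (G : Type*) {K : Type*} [NormedAddCommGroup K] [InnerProductSpace ℂ K]
    (R : K →L[ℂ] K) : lp (fun _ : G => K) 2 →L[ℂ] lp (fun _ : G => K) 2 :=
  weightedShift (Equiv.refl G) (fun _ => R) ‖R‖ fun _ => le_rfl

omit [CompleteSpace K] [Group G] in
theorem constDiag_apply (R : K →L[ℂ] K) (f : lp (fun _ : G => K) 2) (h : G) :
    constDiag G R f h = R (f h) := rfl

omit [Group G] in
theorem star_constDiag (R : K →L[ℂ] K) : star (constDiag G R) = constDiag G (star R) :=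
  star_weightedShift_refl _ (C' := ‖star R‖) fun _ => le_rfl

theorem apply_constDiag {R : K →L[ℂ] K} (hR : ∀ a, Commute (π a) R)
    (T : (α.repCrossedProduct π).Elem) (f : lp (fun _ : G => K) 2) :
    (T : lp (fun _ : G => K) 2 →L[ℂ] lp (fun _ : G => K) 2) (constDiag G R f) =
      constDiag G R ((T : lp (fun _ : G => K) 2 →L[ℂ] lp (fun _ : G => K) 2) f) := by
  have key : ∀ R : K →L[ℂ] K, (∀ a, Commute (π a) R) →
      ∀ s ∈ range (α.repOp π) ∪ range (α.shiftOp π), Commute s (constDiag G R) := fun R hR => by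
    have h : ∀ (x : A) (ξ : K), π x (R ξ) = R (π x ξ) := fun x ξ =>
      congrArg (fun S => S ξ) (hR x).eq
    rintro _ (⟨x, rfl⟩ | ⟨g, rfl⟩)
    · exact clm_ext fun f k => h _ _
    · exact clm_ext fun f k => h _ _
  refine congrArg (fun S => S f)
    (VonNeumannAlgebra.commute_of_mem_generatedBy T.2 (key R hR) ?_).eq
  rw [star_constDiag]
  refine key _ fun a => ?_
  have := (hR (star a)).star_star
  rwa [map_star, star_star] at this

/-- The right translation by `k`, an isometry in the commutant of the crossed product. -/
def rightShift (α : CocycleAction G A) (π : A →⋆ₐ[ℂ] (K →L[ℂ] K)) (U : K ≃ₗᵢ[ℂ] K) (k : G) :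
    lp (fun _ : G => K) 2 ≃ₗᵢ[ℂ] lp (fun _ : G => K) 2 :=
  lpIsometryEquiv (Equiv.mulRight k).symm fun h => U.trans <| Unitary.linearIsometryEquiv
    ⟨π ((α.aut h).symm (star (α.coc h k : A))),
      Unitary.map_mem π (Unitary.map_mem (α.aut h).symm (star (α.coc h k)).2)⟩

theorem rightShift_apply (U : K ≃ₗᵢ[ℂ] K) (k : G) (f : lp (fun _ : G => K) 2) (h : G) :
    rightShift α π U k f h = π ((α.aut h).symm (star (α.coc h k : A))) (U (f (h * k))) := rfl

/-- U implements α_k on K, and the factor α_h⁻¹(v_{h,k}⋆) in the translation corrects for the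
cocycle. Together with the constant right multiplications these translations make δ_e ⊗ 1 cyclic for
the commutant. -/
theorem apply_rightShift {U : K ≃ₗᵢ[ℂ] K} {k : G}
    (hU : ∀ a ξ, U (π a ξ) = π (α.aut k a) (U ξ)) (T : (α.repCrossedProduct π).Elem)
    (f : lp (fun _ : G => K) 2) :
    (T : lp (fun _ : G => K) 2 →L[ℂ] lp (fun _ : G => K) 2) (rightShift α π U k f) =
      rightShift α π U k ((T : lp (fun _ : G => K) 2 →L[ℂ] lp (fun _ : G => K) 2) f) := by
  refine VonNeumannAlgebra.apply_comm_of_mem_generatedBy T.2 (rightShift α π U k) ?_ f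
  rintro _ (⟨x, rfl⟩ | ⟨g, rfl⟩) f
  · refine lp.ext (funext fun h => ?_)
    rw [repOp_apply, rightShift_apply, rightShift_apply, repOp_apply, hU, ← mul_apply_eq_comp,
      ← mul_apply_eq_comp, ← map_mul π, ← map_mul π, aut_symm_mul_star_coc]
  · refine lp.ext (funext fun h => ?_)
    obtain ⟨l, rfl⟩ : ∃ l, h = g * l := ⟨g⁻¹ * h, by group⟩
    rw [shiftOp_apply_mul, rightShift_apply, rightShift_apply, mul_assoc, shiftOp_apply_mul, hU,
      ← mul_apply_eq_comp, ← mul_apply_eq_comp, ← map_mul, ← map_mul, coc_mul_aut_symm_star_coc,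
      mul_assoc]

/-! ### The separating vector -/

open scoped Classical in
/-- The inclusion `ξ ↦ δ_g ⊗ ξ`. -/
def delta (g : G) : K →L[ℂ] lp (fun _ : G => K) 2 :=
  lp.singleContinuousLinearMap ℂ (fun _ : G => K) 2 g

omit [CompleteSpace K] [Group G] in
open scoped Classical in
theorem delta_self (g : G) (ξ : K) : delta g ξ g = ξ := lp.single_apply_self _ _ _

omit [CompleteSpace K] [Group G] in
open scoped Classical in
theorem delta_ne (g : G) (ξ : K) {h : G} (hh : h ≠ g) : delta g ξ h = 0 :=
  lp.single_apply_ne _ _ _ hh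

omit [CompleteSpace K] [Group G] in
open scoped Classical in
theorem norm_delta (g : G) (ξ : K) : ‖delta g ξ‖ = ‖ξ‖ := lp.norm_single (by norm_num) _ _

omit [CompleteSpace K] [Group G] in
theorem eq_delta {f : lp (fun _ : G => K) 2} {g : G} (h : ∀ k, k ≠ g → f k = 0) :
    f = delta g (f g) := by
  refine lp.ext (funext fun k => ?_)
  by_cases hk : k = g
  · rw [hk, delta_self]
  · rw [h k hk, delta_ne g _ hk]

omit [CompleteSpace K] [Group G] in
open scoped Classical in
theorem clm_ext_delta {S T : lp (fun _ : G => K) 2 →L[ℂ] lp (fun _ : G => K) 2}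
    (h : ∀ g ξ, S (delta g ξ) = T (delta g ξ)) : S = T :=
  lp.ext_continuousLinearMap (by norm_num) fun g => ContinuousLinearMap.ext fun ξ => h g ξ

omit [CompleteSpace K] [Group G] in
theorem constDiag_delta (R : K →L[ℂ] K) (g : G) (ξ : K) :
    constDiag G R (delta g ξ) = delta g (R ξ) := by
  rw [eq_delta (f := constDiag G R (delta g ξ)) fun k hk => by
    rw [constDiag_apply, delta_ne _ _ hk, map_zero], constDiag_apply, delta_self]

theorem rightShift_symm_delta (U : K ≃ₗᵢ[ℂ] K) (k : G) (ξ : K) :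
    ∃ η, (rightShift α π U k⁻¹).symm (delta k ξ) = delta 1 η := by
  refine ⟨_, eq_delta fun g hg => ?_⟩
  refine (congrArg _ (delta_ne k ξ (h := g * k⁻¹⁻¹) ?_)).trans (map_zero _)
  rw [inv_inv]
  simpa using hg

theorem repOp_delta (x : A) (g : G) (ξ : K) :
    α.repOp π x (delta g ξ) = delta g (π ((α.aut g).symm x) ξ) := by
  rw [eq_delta (f := α.repOp π x (delta g ξ)) fun k hk => by
    rw [repOp_apply, delta_ne _ _ hk, map_zero], repOp_apply, delta_self]

theorem shiftOp_delta_one (g : G) (ξ : K) : α.shiftOp π g (delta 1 ξ) = delta g ξ := by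
  rw [eq_delta (f := α.shiftOp π g (delta 1 ξ)) (g := g) fun k hk => by
    obtain ⟨l, rfl⟩ : ∃ l, k = g * l := ⟨g⁻¹ * k, by group⟩
    rw [shiftOp_apply_mul, delta_ne, map_zero]
    simpa using hk]
  congr 1
  have := α.shiftOp_apply_mul π g (delta 1 ξ) 1
  rwa [mul_one, delta_self, α.coc_one_right, OneMemClass.coe_one, map_one, map_one,
    one_apply_eq_self] at this

/-- The vector `δ_e ⊗ 1` is separating for the crossed product. -/
theorem eq_of_apply_delta_one {π : StandardRep A K} {U : G → (K ≃ₗᵢ[ℂ] K)}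
    (hU : ∀ k a ξ, U k (π.rep a ξ) = π.rep (α.aut k a) (U k ξ))
    {S T : (α.repCrossedProduct π.rep).Elem}
    (h : (S : lp (fun _ : G => K) 2 →L[ℂ] lp (fun _ : G => K) 2) (delta 1 π.vac) =
      (T : lp (fun _ : G => K) 2 →L[ℂ] lp (fun _ : G => K) 2) (delta 1 π.vac)) : S = T := by
  have h1 : ∀ ξ, (S : lp (fun _ : G => K) 2 →L[ℂ] lp (fun _ : G => K) 2) (delta 1 ξ) =
      (T : lp (fun _ : G => K) 2 →L[ℂ] lp (fun _ : G => K) 2) (delta 1 ξ) := by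
    -- Right multiplications, which lie in the commutant, move δ_e ⊗ 1 to a dense set of vectors δ_e
    -- ⊗ ξ.
    refine congrFun (π.dense_right.equalizer ?_ ?_ (funext fun b => ?_))
    · exact (ContinuousLinearMap.continuous _).comp (ContinuousLinearMap.continuous _)
    · exact (ContinuousLinearMap.continuous _).comp (ContinuousLinearMap.continuous _)
    · simp only [Function.comp_apply]
      rw [← constDiag_delta, apply_constDiag (fun a => π.commute a b), h,
        apply_constDiag (fun a => π.commute a b)]
  refine Subtype.ext (clm_ext_delta fun k ξ => ?_)
  -- Right translation by k⁻¹ moves the summand at e onto the summand at k.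
  obtain ⟨η, hη⟩ := rightShift_symm_delta (α := α) (π := π.rep) (U k⁻¹) k ξ
  rw [← (rightShift α π.rep (U k⁻¹) k⁻¹).apply_symm_apply (delta k ξ), hη,
    apply_rightShift (hU _), apply_rightShift (hU _), h1]

end CocycleAction

/-! ### Intertwiners in a factor -/

namespace StandardRep

variable {A : Type*} [CStarAlgebra A] {K : Type*} [NormedAddCommGroup K] [InnerProductSpace ℂ K]
  [CompleteSpace K] (π : StandardRep A K)
include π

/-- In a factor, a nonzero element intertwining the identity and an automorphism is a multiple of a
unitary that implements the automorphism. -/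
theorem exists_unitary_of_intertwines (hZ : ∀ z : A, (∀ x, z * x = x * z) → ∃ c : ℂ, z = c • 1)
    {t : A} (ht : t ≠ 0) {σ : A ≃⋆ₐ[ℂ] A} (h : ∀ y, t * y = σ y * t) :
    ∃ u : unitary A, t = (‖π.rep t π.vac‖ : ℂ) • (u : A) ∧
      ∀ y, σ y = u * y * star (u : A) := by
  have h' : ∀ y, y * star t = star t * σ y := fun y => by
    have := congrArg star (h (star y))
    rwa [star_mul, star_mul, star_star, map_star, star_star] at this
  -- Both t⋆t and tt⋆ are central, and t(t⋆t) = (tt⋆)t forces the two scalars to agree. Evaluating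
  -- at the unit vector `π.vac` identifies this scalar as r².
  obtain ⟨c, hc⟩ := hZ (star t * t) fun y => by
    rw [mul_assoc, h, ← mul_assoc, ← mul_assoc, h']
  obtain ⟨c', hc'⟩ := hZ (t * star t) fun z => by
    obtain ⟨y, rfl⟩ := EquivLike.surjective σ z
    rw [mul_assoc, ← h', ← mul_assoc, h, mul_assoc]
  have hcc : c' = c := by
    have h1 : t * (star t * t) = t * star t * t := (mul_assoc _ _ _).symm
    rw [hc, hc', mul_smul_comm, mul_one, smul_mul_assoc, one_mul] at h1
    exact (smul_left_injective ℂ ht h1).symm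
  rw [hcc] at hc'
  set r := ‖π.rep t π.vac‖ with hr
  have hcr : c = (r : ℂ) ^ 2 := by
    have h1 : ⟪π.vac, π.rep (star t * t) π.vac⟫_ℂ = (r : ℂ) ^ 2 := by
      rw [map_mul, map_star, mul_apply_eq_comp, ContinuousLinearMap.star_eq_adjoint,
        ContinuousLinearMap.adjoint_inner_right, inner_self_eq_norm_sq_to_K]
      rfl
    rw [hc, map_smul, map_one, _root_.smul_apply, one_apply_eq_self, inner_smul_right,
      inner_self_eq_norm_sq_to_K, π.norm_vac] at h1
    simpa using h1
  have hr0 : (r : ℂ) ≠ 0 := fun h0 => ht <| by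
    rw [hcr, h0, zero_pow two_ne_zero, zero_smul] at hc
    exact CStarRing.star_mul_self_eq_zero_iff t |>.mp hc
  have hstar : star (((r : ℂ)⁻¹) • t) = ((r : ℂ)⁻¹) • star t := by
    rw [star_smul, star_inv₀, Complex.star_def, Complex.conj_ofReal]
  have hone : ((r : ℂ)⁻¹ * ((r : ℂ)⁻¹ * c)) = 1 := by
    rw [hcr]
    field_simp
  have hu : ((r : ℂ)⁻¹) • t ∈ unitary A := by
    rw [Unitary.mem_iff, hstar, smul_mul_smul_comm, smul_mul_smul_comm, hc, hc', smul_smul,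
      mul_assoc, hone, one_smul]
    exact ⟨rfl, rfl⟩
  refine ⟨⟨_, hu⟩, (smul_inv_smul₀ hr0 t).symm, fun y => ?_⟩
  rw [hstar, smul_mul_assoc, smul_mul_smul_comm, h, mul_assoc, hc', mul_smul_comm, mul_one,
    smul_smul, mul_assoc, hone, one_smul]

end StandardRep

/-! ### From normalizing isometries to cocycle conjugacy -/

namespace CocycleAction

/-- An algebra `B` with a copy of `A` and unitaries `u_g` that implement the cocycle action `α`,
such that every isometry inducing an automorphism of `A` is of the form `w u_k`
for a unitary `w` of `A` and a unique `k`. -/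
structure IsRegularExtension {G : Type*} [Group G] {A B : Type*} [Ring A] [StarRing A] [Algebra ℂ A]
    [Ring B] [StarRing B] [Algebra ℂ B] (α : CocycleAction G A) (e : A →⋆ₐ[ℂ] B) (u : G → B) :
    Prop where
  star_mul_self : ∀ g, star (u g) * u g = 1
  mul_star_self : ∀ g, u g * star (u g) = 1
  mul_map : ∀ g x, u g * e x = e (α.aut g x) * u g
  mul_mul : ∀ g h, u g * u h = e (α.coc g h) * u (g * h)
  injective : Function.Injective e
  eq_of_mul_eq : ∀ {w w' : unitary A} {k k' : G}, e w * u k = e w' * u k' → k = k'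
  exists_eq_mul : ∀ T : B, star T * T = 1 → ∀ θ : A ≃⋆ₐ[ℂ] A, (∀ y, T * e y = e (θ y) * T) →
    ∃ (k : G) (w : unitary A), T = e w * u k

namespace IsRegularExtension

variable {G₁ : Type*} [Group G₁] {A₁ B₁ : Type*} [Ring A₁] [StarRing A₁] [Algebra ℂ A₁]
  [Ring B₁] [StarRing B₁] [Algebra ℂ B₁] {α₁ : CocycleAction G₁ A₁} {e₁ : A₁ →⋆ₐ[ℂ] B₁} {u₁ : G₁ → B₁}
  {G₂ : Type*} [Group G₂] {A₂ B₂ : Type*} [Ring A₂] [StarRing A₂] [Algebra ℂ A₂]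
  [Ring B₂] [StarRing B₂] [Algebra ℂ B₂] {α₂ : CocycleAction G₂ A₂} {e₂ : A₂ →⋆ₐ[ℂ] B₂} {u₂ : G₂ → B₂}

theorem mul_inj (h₁ : α₁.IsRegularExtension e₁ u₁) {w w' : unitary A₁} {k k' : G₁}
    (h : e₁ w * u₁ k = e₁ w' * u₁ k') : k = k' ∧ w = w' := by
  obtain rfl := h₁.eq_of_mul_eq h
  refine ⟨rfl, Subtype.ext (h₁.injective ?_)⟩
  have h1 := congrArg (· * star (u₁ k)) h
  simpa only [mul_assoc, h₁.mul_star_self, mul_one] using h1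

/-- Ψ(u_g) is an isometry that induces Φ α_g Φ⁻¹ on the second algebra. -/
theorem exists_apply_eq (h₁ : α₁.IsRegularExtension e₁ u₁) (h₂ : α₂.IsRegularExtension e₂ u₂)
    {Ψ : B₁ ≃⋆ₐ[ℂ] B₂} {Φ : A₁ ≃⋆ₐ[ℂ] A₂} (hΦ : ∀ x, Ψ (e₁ x) = e₂ (Φ x)) (g : G₁) :
    ∃ (k : G₂) (w : unitary A₂), Ψ (u₁ g) = e₂ w * u₂ k := by
  refine h₂.exists_eq_mul _ ?_ ((Φ.symm.trans (α₁.aut g)).trans Φ) fun y => ?_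
  · rw [← map_star Ψ, ← map_mul Ψ, h₁.star_mul_self, map_one Ψ]
  · change _ = e₂ (Φ (α₁.aut g (Φ.symm y))) * _
    rw [← hΦ, ← map_mul Ψ, ← h₁.mul_map, map_mul Ψ, hΦ, StarAlgEquiv.apply_symm_apply]

-- Shows that the index maps obtained from Ψ and from Ψ⁻¹ are inverse to each other.
omit [Group G₁] in
theorem eq_of_apply_eq (h₂ : α₂.IsRegularExtension e₂ u₂)
    {Ψ : B₁ ≃⋆ₐ[ℂ] B₂} {Φ : A₁ ≃⋆ₐ[ℂ] A₂} (hΦ : ∀ x, Ψ (e₁ x) = e₂ (Φ x))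
    {g : G₁} {k k' : G₂} {w : unitary A₂} {w' : unitary A₁}
    (h : Ψ (u₁ g) = e₂ w * u₂ k) (h' : Ψ.symm (u₂ k') = e₁ w' * u₁ g) : k' = k := by
  have h1 := congrArg Ψ h'
  rw [StarAlgEquiv.apply_symm_apply, map_mul Ψ, hΦ, h, ← mul_assoc, ← map_mul] at h1
  refine (h₂.mul_inj (w := 1) (w' := Φ.mapUnitary w' * w) ?_).1
  rw [OneMemClass.coe_one, map_one, one_mul, h1]
  rfl

theorem exists_isCocycleConjugacy (h₁ : α₁.IsRegularExtension e₁ u₁)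
    (h₂ : α₂.IsRegularExtension e₂ u₂) (Ψ : B₁ ≃⋆ₐ[ℂ] B₂) (Φ : A₁ ≃⋆ₐ[ℂ] A₂)
    (hΦ : ∀ x, Ψ (e₁ x) = e₂ (Φ x)) :
    ∃ (γ : G₁ ≃* G₂) (w : G₁ → unitary A₂), α₁.IsCocycleConjugacy α₂ Φ γ w := by
  have hΦ' : ∀ y, Ψ.symm (e₂ y) = e₁ (Φ.symm y) := fun y => by
    rw [← Ψ.symm_apply_apply (e₁ _), hΦ, StarAlgEquiv.apply_symm_apply]
  choose γ w hw using h₁.exists_apply_eq h₂ hΦ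
  choose γ' w' hw' using h₂.exists_apply_eq h₁ hΦ'
  -- Both sides of Ψ(u_g u_h) = Ψ(v_{g,h} u_{gh}) are brought to the form (unitary) · u_k.
  -- Uniqueness of k gives multiplicativity of γ, uniqueness of the unitary gives (ii).
  have hmul : ∀ g h, γ (g * h) = γ g * γ h ∧
      Φ.mapUnitary (α₁.coc g h) * w (g * h) =
        w g * (α₂.aut (γ g)).mapUnitary (w h) * α₂.coc (γ g) (γ h) := fun g h => by
    apply h₂.mul_inj
    have h1 := congrArg Ψ (h₁.mul_mul g h)
    rw [map_mul Ψ, map_mul Ψ, hw, hw, hw, hΦ, mul_assoc, ← mul_assoc (u₂ (γ g)),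
      h₂.mul_map, mul_assoc (e₂ _) (u₂ _), h₂.mul_mul, ← mul_assoc, ← mul_assoc, ← mul_assoc,
      ← map_mul, ← map_mul, ← map_mul] at h1
    exact h1.symm
  refine ⟨⟨⟨γ, γ', fun g => (h₁.eq_of_apply_eq hΦ' (hw' (γ g)) (hw g)).symm,
    fun k => (h₂.eq_of_apply_eq hΦ (hw (γ' k)) (hw' k)).symm⟩, fun g h => (hmul g h).1⟩,
    w, ⟨fun g y => ?_, fun g h => ?_⟩⟩
  · refine h₂.injective ?_
    have h1 := congrArg Ψ (h₁.mul_map g (Φ.symm y))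
    rw [map_mul Ψ, map_mul Ψ, hw, hΦ, hΦ, StarAlgEquiv.apply_symm_apply, mul_assoc,
      h₂.mul_map, ← mul_assoc, ← mul_assoc, ← map_mul, ← map_mul] at h1
    have h2 := congrArg (fun z => z * star (u₂ (γ g)) * e₂ (star (w g : A₂))) h1
    simp only [mul_assoc _ (u₂ _), h₂.mul_star_self, mul_one] at h2
    rw [← map_mul, ← map_mul, mul_assoc (Φ _), Unitary.mul_star_self_of_mem (w g).2, mul_one] at h2
    exact congrArg e₂ (h₂.injective h2).symm
  · have h1 := congrArg (fun x : unitary A₂ => (x : A₂) * star (w (g * h) : A₂)) (hmul g h).2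
    simp only [Submonoid.coe_mul] at h1
    rw [mul_assoc, Unitary.mul_star_self_of_mem (w (g * h)).2, mul_one] at h1
    exact h1

end IsRegularExtension

end CocycleAction

/-! ### The normalizer of the factor in its crossed product -/

namespace CocycleAction

section normalizer

variable {A : Type*} [CStarAlgebra A] {K : Type*} [NormedAddCommGroup K] [InnerProductSpace ℂ K]
  [CompleteSpace K] {G : Type*} [Group G] {α : CocycleAction G A} {π : StandardRep A K}

/-- The hypotheses give α_k⁻¹α_h = Ad(w u⋆). Since α_k α_{k⁻¹h} = Ad(v_{k,k⁻¹h}) α_h, the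
automorphism α_{k⁻¹h} is inner, implemented by α_k⁻¹(v_{k,k⁻¹h}) w u⋆. -/
theorem ProperlyOuter.eq_of_eq_inner (hα : α.ProperlyOuter) {θ : A ≃⋆ₐ[ℂ] A} {h k : G}
    {u w : unitary A} (hu : ∀ y, (α.aut h).symm (θ y) = u * y * star (u : A))
    (hw : ∀ y, (α.aut k).symm (θ y) = w * y * star (w : A)) : h = k := by
  by_contra hne
  refine hα (k⁻¹ * h) (fun h1 => hne (inv_mul_eq_one.mp h1).symm)
    ⟨(α.aut k).symm.mapUnitary (α.coc k (k⁻¹ * h)) * w * star u, fun x => ?_⟩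
  have h1 := α.aut_mul k (k⁻¹ * h) x
  rw [mul_inv_cancel_left] at h1
  have h2 : θ (star (u : A) * x * u) = α.aut h x := by
    rw [← (α.aut h).apply_symm_apply (θ _), hu]
    congr 1
    simp only [← mul_assoc]
    rw [Unitary.mul_star_self_of_mem u.2, one_mul, mul_assoc, Unitary.mul_star_self_of_mem u.2,
      mul_one]
  have h3 : (α.aut k).symm (α.aut h x) = w * (star (u : A) * x * u) * star (w : A) := by
    rw [← h2, hw]
  rw [← (α.aut k).symm_apply_apply (α.aut (k⁻¹ * h) x), h1, map_mul, map_mul, h3]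
  simp only [StarAlgEquiv.mapUnitary, Submonoid.coe_mul, Unitary.coe_star, star_mul, star_star,
    mul_assoc, map_star]

variable (α π) in
theorem repHom_injective : Function.Injective (α.repHom π.rep) := by
  rw [injective_iff_map_eq_zero]
  intro x hx
  rw [← map_eq_zero_iff π.rep π.rep_injective]
  ext ξ
  have h := congrArg (fun T : (α.repCrossedProduct π.rep).Elem =>
    (T : lp (fun _ : G => K) 2 →L[ℂ] lp (fun _ : G => K) 2) (delta 1 ξ) 1) hx
  change α.repOp π.rep x (delta 1 ξ) 1 = 0 at h
  rwa [repOp_apply, delta_self, aut_one_symm] at h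

variable (π) in
theorem eq_of_repHom_mul_groupElem_eq {w w' : unitary A} {k k' : G}
    (h : α.repHom π.rep w * α.groupElem π.rep k = α.repHom π.rep w' * α.groupElem π.rep k') :
    k = k' := by
  by_contra hne
  have h1 := congrArg (fun T : (α.repCrossedProduct π.rep).Elem =>
    (T : lp (fun _ : G => K) 2 →L[ℂ] lp (fun _ : G => K) 2) (delta 1 π.vac) k) h
  change α.repOp π.rep w (α.shiftOp π.rep k (delta 1 π.vac)) k =
    α.repOp π.rep w' (α.shiftOp π.rep k' (delta 1 π.vac)) k at h1
  rw [shiftOp_delta_one, shiftOp_delta_one, repOp_delta, repOp_delta, delta_self,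
    delta_ne _ _ hne] at h1
  have h2 := ContinuousLinearMap.norm_map_of_mem_unitary
    (Unitary.map_mem π.rep (Unitary.map_mem (α.aut k).symm w.2)) π.vac
  rw [h1, norm_zero, π.norm_vac] at h2
  exact zero_ne_one h2

/-- An isometry in the crossed product by a properly outer cocycle action of a factor that
normalizes the factor is the product of a unitary of the factor and a canonical unitary. -/
theorem exists_eq_repHom_mul_groupElem {U : G → (K ≃ₗᵢ[ℂ] K)}
    (hU : ∀ k a ξ, U k (π.rep a ξ) = π.rep (α.aut k a) (U k ξ))
    (hZ : ∀ z : A, (∀ x, z * x = x * z) → ∃ c : ℂ, z = c • 1) (hα : α.ProperlyOuter)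
    {T : (α.repCrossedProduct π.rep).Elem} (hT : star T * T = 1) {θ : A ≃⋆ₐ[ℂ] A}
    (hθ : ∀ y, T * α.repHom π.rep y = α.repHom π.rep (θ y) * T) :
    ∃ (k : G) (w : unitary A), T = α.repHom π.rep w * α.groupElem π.rep k := by
  obtain ⟨T₀, hT₀⟩ : ∃ T₀ : lp (fun _ : G => K) 2 →L[ℂ] lp (fun _ : G => K) 2, T₀ = T := ⟨_, rfl⟩
  have hdiag : ∀ b f, T₀ (constDiag G (π.right b) f) = constDiag G (π.right b) (T₀ f) :=
    fun b f => by rw [hT₀, apply_constDiag (fun a => π.commute a b)]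
  have hrep : ∀ y f, T₀ (α.repOp π.rep y f) = α.repOp π.rep (θ y) (T₀ f) := fun y f => by
    have := congrArg (fun S : (α.repCrossedProduct π.rep).Elem =>
      (S : lp (fun _ : G => K) 2 →L[ℂ] lp (fun _ : G => K) 2) f) (hθ y)
    rw [hT₀]
    exact this
  have hnorm : ∀ f, ‖T₀ f‖ = ‖f‖ := by
    rw [ContinuousLinearMap.norm_map_iff_adjoint_comp_self, hT₀]
    exact congrArg Subtype.val hT
  -- The Fourier coefficients of T. The compression ξ ↦ (T(δ_e ⊗ ξ))(h) commutes with right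
  -- multiplication, so by the commutation theorem it is left multiplication by some t_h.
  choose t ht using fun h : G => π.exists_rep_eq
    (lp.evalCLM ℂ (fun _ : G => K) 2 h ∘L T₀ ∘L delta (1 : G)) fun b =>
      ContinuousLinearMap.ext fun ξ => by
        change T₀ (delta 1 (π.right b ξ)) h = π.right b (T₀ (delta 1 ξ) h)
        rw [← constDiag_delta, hdiag, constDiag_apply]
  have ht' : ∀ h ξ, T₀ (delta 1 ξ) h = π.rep (t h) ξ := fun h ξ => by rw [ht]; rfl
  have hint : ∀ h y, t h * y = (θ.trans (α.aut h).symm) y * t h := fun h y => by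
    refine π.rep_injective (ContinuousLinearMap.ext fun ξ => ?_)
    rw [map_mul, map_mul, mul_apply_eq_comp, mul_apply_eq_comp, ← ht', ← ht']
    have h1 : delta (1 : G) (π.rep y ξ) = α.repOp π.rep y (delta 1 ξ) := by
      rw [repOp_delta, aut_one_symm]
    rw [h1, hrep, repOp_apply]
    rfl
  have hne : ∃ k, t k ≠ 0 := by
    by_contra! h0
    have h1 : T₀ (delta 1 π.vac) = 0 := lp.ext <| funext fun h => by
      rw [ht', h0, map_zero]
      rfl
    have h2 := hnorm (delta 1 π.vac)
    rw [h1, norm_zero, norm_delta, π.norm_vac] at h2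
    exact zero_ne_one h2
  obtain ⟨k, hk⟩ := hne
  obtain ⟨u, hu, hu'⟩ := π.exists_unitary_of_intertwines hZ hk (hint k)
  have hsupp : ∀ h, h ≠ k → t h = 0 := fun h hhk => by
    by_contra hh
    obtain ⟨w, -, hw⟩ := π.exists_unitary_of_intertwines hZ hh (hint h)
    exact hhk (hα.eq_of_eq_inner (θ := θ) hw hu')
  have hTδ : T₀ (delta 1 π.vac) = delta k (π.rep (t k) π.vac) := by
    rw [← ht']
    exact eq_delta fun h hh => by rw [ht', hsupp h hh, map_zero, _root_.zero_apply]
  -- T is isometric and only one coefficient survives, so t_k is itself unitary. Then T and α_k(t_k)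
  -- u_k agree on the separating vector.
  have hone : ‖π.rep (t k) π.vac‖ = 1 := by
    rw [← norm_delta k, ← hTδ, hnorm, norm_delta, π.norm_vac]
  rw [hone, Complex.ofReal_one, one_smul] at hu
  refine ⟨k, (α.aut k).mapUnitary u, eq_of_apply_delta_one hU ?_⟩
  rw [← hT₀, hTδ]
  change _ = α.repOp π.rep (α.aut k u) (α.shiftOp π.rep k (delta 1 π.vac))
  rw [shiftOp_delta_one, repOp_delta, StarAlgEquiv.symm_apply_apply, hu]

theorem isRegularExtension {U : G → (K ≃ₗᵢ[ℂ] K)}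
    (hU : ∀ k a ξ, U k (π.rep a ξ) = π.rep (α.aut k a) (U k ξ))
    (hZ : ∀ z : A, (∀ x, z * x = x * z) → ∃ c : ℂ, z = c • 1) (hα : α.ProperlyOuter) :
    α.IsRegularExtension (α.repHom π.rep) (α.groupElem π.rep) where
  star_mul_self := α.star_groupElem_mul π.rep
  mul_star_self := α.groupElem_mul_star π.rep
  mul_map := α.groupElem_mul_repHom π.rep
  mul_mul := α.groupElem_mul_groupElem π.rep
  injective := repHom_injective α π
  eq_of_mul_eq := eq_of_repHom_mul_groupElem_eq π
  exists_eq_mul _ hT _ hθ := exists_eq_repHom_mul_groupElem hU hZ hα hT hθ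

end normalizer

/-! ### A cocycle conjugacy induces a spatial isomorphism -/

section conjugacy

variable {A₁ : Type*} [CStarAlgebra A₁] {K₁ : Type*} [NormedAddCommGroup K₁]
  [InnerProductSpace ℂ K₁] [CompleteSpace K₁] {G₁ : Type*} [Group G₁] {α₁ : CocycleAction G₁ A₁}
  {π₁ : StandardRep A₁ K₁}
  {A₂ : Type*} [CStarAlgebra A₂] {K₂ : Type*} [NormedAddCommGroup K₂]
  [InnerProductSpace ℂ K₂] [CompleteSpace K₂] {G₂ : Type*} [Group G₂] {α₂ : CocycleAction G₂ A₂}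
  {π₂ : StandardRep A₂ K₂}

/-- Relation (i) in the form needed coefficientwise: it moves Φ(α_l⁻¹(x)) past the weight of the
unitary W of the next theorem. -/
theorem IsCocycleConjugacy.mul_apply_symm {Φ : A₁ ≃⋆ₐ[ℂ] A₂} {γ : G₁ ≃* G₂} {w : G₁ → unitary A₂}
    (h : α₁.IsCocycleConjugacy α₂ Φ γ w) (l : G₁) (x : A₁) :
    (α₂.aut (γ l)).symm (w l) * Φ ((α₁.aut l).symm x) =
      (α₂.aut (γ l)).symm (Φ x * w l) := by
  have h1 := h.conj_aut l (Φ ((α₁.aut l).symm x))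
  rw [StarAlgEquiv.symm_apply_apply, StarAlgEquiv.apply_symm_apply] at h1
  rw [h1, mul_assoc, Unitary.coe_star_mul_self, mul_one, map_mul, StarAlgEquiv.symm_apply_apply]

theorem IsCocycleConjugacy.exists_starAlgEquiv {Φ : A₁ ≃⋆ₐ[ℂ] A₂} {γ : G₁ ≃* G₂}
    {w : G₁ → unitary A₂} (h : α₁.IsCocycleConjugacy α₂ Φ γ w)
    {ρ₁ : A₁ →⋆ₐ[ℂ] (K₁ →L[ℂ] K₁)} {ρ₂ : A₂ →⋆ₐ[ℂ] (K₂ →L[ℂ] K₂)} (V : K₁ ≃ₗᵢ[ℂ] K₂)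
    (hV : ∀ a ξ, V (ρ₁ a ξ) = ρ₂ (Φ a) (V ξ)) :
    ∃ Ψ : (α₁.repCrossedProduct ρ₁).Elem ≃⋆ₐ[ℂ] (α₂.repCrossedProduct ρ₂).Elem,
      ∀ x, Ψ (α₁.repHom ρ₁ x) = α₂.repHom ρ₂ (Φ x) := by
  let W : lp (fun _ : G₁ => K₁) 2 ≃ₗᵢ[ℂ] lp (fun _ : G₂ => K₂) 2 :=
    lpIsometryEquiv γ.toEquiv fun k => V.trans <| Unitary.linearIsometryEquiv
      ⟨ρ₂ ((α₂.aut k).symm (w (γ.symm k))),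
        Unitary.map_mem ρ₂ (Unitary.map_mem (α₂.aut k).symm (w (γ.symm k)).2)⟩
  have hW0 : ∀ f k, W f k = ρ₂ ((α₂.aut k).symm (w (γ.symm k))) (V (f (γ.symm k))) :=
    fun f k => rfl
  have hW : ∀ f l, W f (γ l) = ρ₂ ((α₂.aut (γ l)).symm (w l)) (V (f l)) := fun f l => by
    rw [hW0, MulEquiv.symm_apply_apply]
  have hbase : ∀ x f, W (α₁.repOp ρ₁ x f) = α₂.repOp ρ₂ (Φ x) (W f) := fun x f => by
    refine lp.ext (funext fun k => ?_)
    obtain ⟨l, rfl⟩ := γ.surjective k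
    rw [hW, repOp_apply, repOp_apply, hW, hV, ← mul_apply_eq_comp, ← mul_apply_eq_comp,
      ← map_mul ρ₂, ← map_mul ρ₂, h.mul_apply_symm, map_mul]
  have hshift : ∀ g f, W (α₁.shiftOp ρ₁ g f) =
      α₂.repOp ρ₂ (w g) (α₂.shiftOp ρ₂ (γ g) (W f)) := fun g f => by
    refine lp.ext (funext fun k => ?_)
    obtain ⟨k, rfl⟩ := γ.surjective k
    obtain ⟨l, rfl⟩ : ∃ l, k = g * l := ⟨g⁻¹ * k, by group⟩
    -- The coefficient of W u_g = w_g u_{γ(g)} W at γ(g l). Relation (ii) enters here, with w_{gl}⋆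
    -- cancelling the weight of W.
    have key : (α₂.aut (γ (g * l))).symm (w (g * l)) * Φ ((α₁.aut (g * l)).symm (α₁.coc g l)) =
        (α₂.aut (γ (g * l))).symm (w g) * ((α₂.aut (γ (g * l))).symm (α₂.coc (γ g) (γ l)) *
          (α₂.aut (γ l)).symm (w l)) := by
      rw [h.mul_apply_symm, h.map_coc, mul_assoc, Unitary.coe_star_mul_self, mul_one,
        map_mul γ, coc_mul_aut_symm, ← map_mul ((α₂.aut _).symm), mul_assoc]
    rw [hW, shiftOp_apply_mul, hV, repOp_apply, ← mul_apply_eq_comp, ← map_mul ρ₂, key,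
      map_mul γ, shiftOp_apply_mul, hW, ← mul_apply_eq_comp, ← mul_apply_eq_comp, ← map_mul ρ₂,
      ← map_mul ρ₂, mul_assoc]
  have hconj : ∀ {S T}, (∀ f, W (S f) = T (W f)) → W.conjStarAlgEquiv S = T := fun {S T} hST =>
    ContinuousLinearMap.ext fun f => by
      rw [LinearIsometryEquiv.conjStarAlgEquiv_apply_apply, hST,
        LinearIsometryEquiv.apply_symm_apply]
  have hbase' := fun x => hconj (hbase x)
  have hshift' : ∀ g, W.conjStarAlgEquiv (α₁.shiftOp ρ₁ g) =
      α₂.repOp ρ₂ (w g) * α₂.shiftOp ρ₂ (γ g) := fun g => hconj (hshift g)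
  refine ⟨VonNeumannAlgebra.conjEquiv W ?_ ?_, fun x => Subtype.ext (hbase' x)⟩
  · rintro _ (⟨x, rfl⟩ | ⟨g, rfl⟩)
    · rw [hbase']
      exact (α₂.repHom ρ₂ (Φ x)).2
    · rw [hshift']
      exact (α₂.repHom ρ₂ (w g) * α₂.groupElem ρ₂ (γ g)).2
  · rintro _ (⟨y, rfl⟩ | ⟨k, rfl⟩)
    · rw [← Φ.apply_symm_apply y, ← hbase', StarAlgEquiv.symm_apply_apply]
      exact (α₁.repHom ρ₁ (Φ.symm y)).2
    · obtain ⟨g, rfl⟩ := γ.surjective k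
      -- The preimage of u_{γ(g)} is Φ⁻¹(w_g⋆) u_g.
      have h1 : W.conjStarAlgEquiv (α₁.repOp ρ₁ (Φ.symm (star (w g : A₂))) * α₁.shiftOp ρ₁ g) =
          α₂.shiftOp ρ₂ (γ g) := by
        rw [map_mul W.conjStarAlgEquiv, hbase', hshift', StarAlgEquiv.apply_symm_apply, ← mul_assoc]
        have h2 : α₂.repOp ρ₂ (star (w g : A₂)) * α₂.repOp ρ₂ (w g) = 1 := by
          have h3 : α₂.repHom ρ₂ (star (w g : A₂)) * α₂.repHom ρ₂ (w g) = 1 := by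
            rw [← map_mul, Unitary.coe_star_mul_self, map_one]
          exact congrArg Subtype.val h3
        rw [h2, one_mul]
      rw [← h1, StarAlgEquiv.symm_apply_apply]
      exact (α₁.repHom ρ₁ (Φ.symm (star (w g : A₂))) * α₁.groupElem ρ₁ g).2

end conjugacy

end CocycleAction

/-- The restriction of a ⋆-isomorphism to subalgebras given as images of injective
⋆-homomorphisms. -/
theorem StarAlgEquiv.exists_restrict {A₁ A₂ B₁ B₂ : Type*} [Ring A₁] [StarRing A₁] [Algebra ℂ A₁]
    [Ring A₂] [StarRing A₂] [Algebra ℂ A₂] [Ring B₁] [StarRing B₁] [Algebra ℂ B₁]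
    [Ring B₂] [StarRing B₂] [Algebra ℂ B₂] {e₁ : A₁ →⋆ₐ[ℂ] B₁} (he₁ : Function.Injective e₁)
    {e₂ : A₂ →⋆ₐ[ℂ] B₂} (he₂ : Function.Injective e₂) (Ψ : B₁ ≃⋆ₐ[ℂ] B₂)
    (h : Ψ '' range e₁ = range e₂) : ∃ Φ : A₁ ≃⋆ₐ[ℂ] A₂, ∀ x, Ψ (e₁ x) = e₂ (Φ x) := by
  have h1 : ∀ x, ∃ y, e₂ y = Ψ (e₁ x) := fun x => by
    have : Ψ (e₁ x) ∈ range e₂ := h ▸ mem_image_of_mem _ (mem_range_self x)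
    exact this
  have h2 : ∀ y, ∃ x, Ψ (e₁ x) = e₂ y := fun y => by
    have : e₂ y ∈ Ψ '' range e₁ := h ▸ mem_range_self y
    obtain ⟨_, ⟨x, rfl⟩, hx⟩ := this
    exact ⟨x, hx⟩
  choose f hf using h1
  choose f' hf' using h2
  exact ⟨{
    toFun := f
    invFun := f'
    left_inv := fun x => he₁ (EquivLike.injective Ψ (by rw [hf', hf]))
    right_inv := fun y => he₂ (by rw [hf, hf'])
    map_mul' := fun x y => he₂ (by rw [map_mul, hf, hf, hf, map_mul, map_mul])
    map_add' := fun x y => he₂ (by rw [map_add, hf, hf, hf, map_add, map_add])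
    map_star' := fun x => he₂ (by rw [map_star, hf, hf, map_star, map_star])
    map_smul' := fun c x => he₂ (by rw [map_smul, hf, hf, map_smul, map_smul]) },
    fun x => (hf x).symm⟩

/-- The GNS representation of a normalized complete trace. -/
def PositiveLinearMap.IsCompleteTrace.standardRep {A : Type*} [CStarAlgebra A] [PartialOrder A]
    [StarOrderedRing A] {τ : A →ₚ[ℂ] ℂ} (hτ : τ.IsCompleteTrace) (h1 : τ 1 = 1) :
    StandardRep A τ.GNS where
  rep := τ.gnsStarAlgHom
  right := hτ.rightMul
  vac := (τ.toPreGNS 1 : τ.GNS)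
  rep_injective := hτ.gnsStarAlgHom_injective
  commute := hτ.commute_gnsStarAlgHom_rightMul
  exists_rep_eq _ hT := hτ.exists_gnsStarAlgHom_eq hT
  norm_vac := by
    rw [UniformSpace.Completion.norm_coe, ← sq_eq_sq₀ (norm_nonneg _) zero_le_one,
      norm_toPreGNS_sq, star_one, one_mul, h1, Complex.one_re, one_pow]
  dense_right := by
    simp only [hτ.rightMul_coe, one_mul]
    exact UniformSpace.Completion.denseRange_coe.comp τ.toPreGNS.surjective.denseRange
      (UniformSpace.Completion.continuous_coe _)

/-! ### Transfer to the crossed products on the GNS spaces -/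

namespace CocycleAction

section bridge

variable {A : Type*} [CStarAlgebra A] {K : Type*} [NormedAddCommGroup K] [InnerProductSpace ℂ K]
  [CompleteSpace K] {G : Type*} [Group G] {α : CocycleAction G A}
  {N : VonNeumannAlgebra (lp (fun _ : G => K) 2)} {b : A → N.Elem}
  {A₂ : Type*} [CStarAlgebra A₂] {K₂ : Type*} [NormedAddCommGroup K₂] [InnerProductSpace ℂ K₂]
  [CompleteSpace K₂] {G₂ : Type*} [Group G₂] {α₂ : CocycleAction G₂ A₂}
  {N₂ : VonNeumannAlgebra (lp (fun _ : G₂ => K₂) 2)} {b₂ : A₂ → N₂.Elem}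

/-- An isomorphism of crossed products by properly outer cocycle actions of factors that maps the
factors onto each other is given by a cocycle conjugacy. -/
theorem exists_isCocycleConjugacy
    {π : StandardRep A K} {U : G → (K ≃ₗᵢ[ℂ] K)}
    (hU : ∀ k a ξ, U k (π.rep a ξ) = π.rep (α.aut k a) (U k ξ))
    (hZ : ∀ z : A, (∀ x, z * x = x * z) → ∃ c : ℂ, z = c • 1) (hα : α.ProperlyOuter)
    (hN : N = α.repCrossedProduct π.rep) (hb : ∀ x, (b x : _ →L[ℂ] _) = α.repOp π.rep x)
    {π₂ : StandardRep A₂ K₂} {U₂ : G₂ → (K₂ ≃ₗᵢ[ℂ] K₂)}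
    (hU₂ : ∀ k a ξ, U₂ k (π₂.rep a ξ) = π₂.rep (α₂.aut k a) (U₂ k ξ))
    (hZ₂ : ∀ z : A₂, (∀ x, z * x = x * z) → ∃ c : ℂ, z = c • 1) (hα₂ : α₂.ProperlyOuter)
    (hN₂ : N₂ = α₂.repCrossedProduct π₂.rep)
    (hb₂ : ∀ x, (b₂ x : _ →L[ℂ] _) = α₂.repOp π₂.rep x)
    (Ψ : N.Elem ≃⋆ₐ[ℂ] N₂.Elem) (hΨ : Ψ '' range b = range b₂) :
    ∃ Φ : A ≃⋆ₐ[ℂ] A₂, (∀ x, Ψ (b x) = b₂ (Φ x)) ∧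
      ∃ (γ : G ≃* G₂) (w : G → unitary A₂), α.IsCocycleConjugacy α₂ Φ γ w := by
  subst hN hN₂
  obtain rfl : b = fun x => α.repHom π.rep x := funext fun x => Subtype.ext (hb x)
  obtain rfl : b₂ = fun x => α₂.repHom π₂.rep x := funext fun x => Subtype.ext (hb₂ x)
  have h₁ := isRegularExtension hU hZ hα
  have h₂ := isRegularExtension hU₂ hZ₂ hα₂
  obtain ⟨Φ, hΦ⟩ := StarAlgEquiv.exists_restrict h₁.injective h₂.injective Ψ hΨ
  exact ⟨Φ, hΦ, h₁.exists_isCocycleConjugacy h₂ Ψ Φ hΦ⟩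

theorem IsCocycleConjugacy.exists_starAlgEquiv_of_eq {Φ : A ≃⋆ₐ[ℂ] A₂}
    {γ : G ≃* G₂} {w : G → unitary A₂} (h : α.IsCocycleConjugacy α₂ Φ γ w)
    {ρ : A →⋆ₐ[ℂ] (K →L[ℂ] K)} {ρ₂ : A₂ →⋆ₐ[ℂ] (K₂ →L[ℂ] K₂)}
    (hN : N = α.repCrossedProduct ρ) (hb : ∀ x, (b x : _ →L[ℂ] _) = α.repOp ρ x)
    (hN₂ : N₂ = α₂.repCrossedProduct ρ₂)
    (hb₂ : ∀ x, (b₂ x : _ →L[ℂ] _) = α₂.repOp ρ₂ x) (V : K ≃ₗᵢ[ℂ] K₂)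
    (hV : ∀ a ξ, V (ρ a ξ) = ρ₂ (Φ a) (V ξ)) :
    ∃ Ψ : N.Elem ≃⋆ₐ[ℂ] N₂.Elem, ∀ x, Ψ (b x) = b₂ (Φ x) := by
  subst hN hN₂
  obtain rfl : b = fun x => α.repHom ρ x := funext fun x => Subtype.ext (hb x)
  obtain rfl : b₂ = fun x => α₂.repHom ρ₂ x := funext fun x => Subtype.ext (hb₂ x)
  exact h.exists_starAlgEquiv V hV

end bridge

section crossedProduct

variable {H : Type*} [NormedAddCommGroup H] [InnerProductSpace ℂ H] [CompleteSpace H]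
  {M : VonNeumannAlgebra H} {G : Type*} [Group G]

theorem crossedProduct_eq_repCrossedProduct (α : CocycleAction G M.Elem) (τ : M.Elem →ₚ[ℂ] ℂ) :
    α.crossedProduct τ = α.repCrossedProduct τ.gnsStarAlgHom := rfl

theorem coe_base (α : CocycleAction G M.Elem) (τ : M.Elem →ₚ[ℂ] ℂ) (x : M.Elem) :
    (α.base τ x : α.L2 τ →L[ℂ] α.L2 τ) = α.repOp τ.gnsStarAlgHom x := rfl

end crossedProduct

end CocycleAction

end

theorem proposition1p7
    {H₁ : Type*} [NormedAddCommGroup H₁] [InnerProductSpace ℂ H₁] [CompleteSpace H₁]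
    {H₂ : Type*} [NormedAddCommGroup H₂] [InnerProductSpace ℂ H₂] [CompleteSpace H₂]
    {G₁ : Type*} [Group G₁] {G₂ : Type*} [Group G₂]
    (M₁ : VonNeumannAlgebra H₁) (M₂ : VonNeumannAlgebra H₂)
    (hM₁ : M₁.IsTypeIIOneFactor) (hM₂ : M₂.IsTypeIIOneFactor)
    (τ₁ : M₁.Elem →ₚ[ℂ] ℂ) (hτ₁ : M₁.IsFaithfulNormalTrace τ₁)
    (τ₂ : M₂.Elem →ₚ[ℂ] ℂ) (hτ₂ : M₂.IsFaithfulNormalTrace τ₂)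
    (α₁ : CocycleAction G₁ M₁.Elem) (α₂ : CocycleAction G₂ M₂.Elem)
    (hα₁ : α₁.ProperlyOuter) (hα₂ : α₂.ProperlyOuter) :
    (∀ Ψ : (α₁.crossedProduct τ₁).Elem ≃⋆ₐ[ℂ] (α₂.crossedProduct τ₂).Elem,
      Ψ '' Set.range (α₁.base τ₁) = Set.range (α₂.base τ₂) →
      ∃ Φ : M₁.Elem ≃⋆ₐ[ℂ] M₂.Elem,
        (∀ x, Ψ (α₁.base τ₁ x) = α₂.base τ₂ (Φ x)) ∧
        ∃ (γ : G₁ ≃* G₂) (w : G₁ → unitary M₂.Elem),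
          α₁.IsCocycleConjugacy α₂ Φ γ w) ∧
    (∀ (Φ : M₁.Elem ≃⋆ₐ[ℂ] M₂.Elem) (γ : G₁ ≃* G₂) (w : G₁ → unitary M₂.Elem),
      α₁.IsCocycleConjugacy α₂ Φ γ w →
      ∃ Ψ : (α₁.crossedProduct τ₁).Elem ≃⋆ₐ[ℂ] (α₂.crossedProduct τ₂).Elem,
        ∀ x, Ψ (α₁.base τ₁ x) = α₂.base τ₂ (Φ x)) := by
  refine ⟨fun Ψ hΨ => ?_, fun Φ γ w h => ?_⟩
  · exact CocycleAction.exists_isCocycleConjugacy (A := M₁.Elem) (A₂ := M₂.Elem)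
      (K := τ₁.GNS) (K₂ := τ₂.GNS) (α := α₁) (α₂ := α₂)
      (N := α₁.crossedProduct τ₁) (N₂ := α₂.crossedProduct τ₂)
      (b := α₁.base τ₁) (b₂ := α₂.base τ₂)
      (π := hτ₁.isCompleteTrace.standardRep hτ₁.map_one)
      (π₂ := hτ₂.isCompleteTrace.standardRep hτ₂.map_one)
      -- The implementing unitary of α_k on L² exists because α_k preserves the trace.
      (fun k => PositiveLinearMap.gnsEquiv_gnsStarAlgHom (α₁.aut k)
        (hτ₁.apply_starAlgEquiv hM₁.center_trivial hτ₁ (α₁.aut k))) hM₁.center_trivial hα₁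
      (α₁.crossedProduct_eq_repCrossedProduct τ₁) (α₁.coe_base τ₁)
      (fun k => PositiveLinearMap.gnsEquiv_gnsStarAlgHom (α₂.aut k)
        (hτ₂.apply_starAlgEquiv hM₂.center_trivial hτ₂ (α₂.aut k))) hM₂.center_trivial hα₂
      (α₂.crossedProduct_eq_repCrossedProduct τ₂) (α₂.coe_base τ₂) Ψ hΨ
  · exact CocycleAction.IsCocycleConjugacy.exists_starAlgEquiv_of_eq (A := M₁.Elem) (A₂ := M₂.Elem)
      (K := τ₁.GNS) (K₂ := τ₂.GNS) (α := α₁) (α₂ := α₂)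
      (N := α₁.crossedProduct τ₁) (N₂ := α₂.crossedProduct τ₂)
      (b := α₁.base τ₁) (b₂ := α₂.base τ₂) h
      (α₁.crossedProduct_eq_repCrossedProduct τ₁) (α₁.coe_base τ₁)
      (α₂.crossedProduct_eq_repCrossedProduct τ₂) (α₂.coe_base τ₂)
      (PositiveLinearMap.gnsEquiv Φ (hτ₁.apply_starAlgEquiv hM₁.center_trivial hτ₂ Φ))
      (PositiveLinearMap.gnsEquiv_gnsStarAlgHom Φ _)
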